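/- Consider the class of all functions $L(s)$, $s=\sigma+it$, with the following properties. (a) For some integer $m\ge 1$ (the degree), some $0\le\vartheta\le 1$ and some complex numbers $\alpha_j(p)$ ($p$ prime, $1\le j\le m$) with $|\alpha_j(p)|\le p^{\vartheta}$, the Euler product $$L(s)=\prod_p\prod_{j=1}^m\left(1-\frac{\alpha_j(p)}{p^s}\right)^{-1}$$ converges absolutely for $\sigma>1$. (b) For some integer $N_L\ge 1$ and some complex numbers $\mu_1,\dots,\mu_m$ with $\Re(\mu_j)>-1$ that are closed under complex conjugation (with multiplicity), the completed function $$\xi_L(s)=L(s)\,N_L^{s/2}\prod_{j=1}^m\Gamma_{\mathbb R}(s+\mu_j),\qquad \Gamma_{\mathbb R}(s)=\pi^{-s/2}\Gamma(s/2),$$ extends to a meromorphic function on $\mathbb C$ of order $1$. It has no poles outside $\{0,1\}$, and for some integer $0\le r_L\le m$ it has a pole of order $r_L$ at each of $0$ and $1$ (no pole if $r_L=0$). The function $L(s)$ has no pole at $s=0$, so that it is holomorphic on $\mathbb C\setminus\{1\}$. There is $\kappa\in\mathbb C$ with $|\kappa|=1$ such that $\xi_L(s)=\kappa\,\overline{\xi_L(1-\overline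 s)}$. A zero of $L(s)$ is called non-trivial if, counting multiplicity, it does not merely arise from the poles of the Gamma factors, that is, if it is also a zero of $\xi_L(s)$. There is a universal constant $N_0>0$ such that for every $L$ in this class and every real $T$ the rectangle $0\le\sigma\le 1$, $T-N_0\le t\le T+N_0$ contains a non-trivial zero of $L(s)$. In particular, any two consecutive ordinates of non-trivial zeros of $L(s)$ differ by at most $2N_0$. -/

import Mathlib

open Filter

noncomputable section

/-- `f` has growth order `a`: `a` is the infimum of the exponents `b > 0` with
`f(s) = O(exp(|s|^b))` as `|s| → ∞`. This is the usual order of growth for a meromorphic function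
on `ℂ` with finitely many poles. -/
def HasGrowthOrder (f : ℂ → ℂ) (a : ℝ) : Prop :=
  IsGLB {b : ℝ | 0 < b ∧ f =O[cocompact ℂ] fun s => Real.exp (‖s‖ ^ b)} a

/-- The pole of `f` at `z` has order exactly `r`; for `r = 0` this says that `f` has no pole
at `z`. -/
def HasPoleOrder (f : ℂ → ℂ) (z : ℂ) (r : ℕ) : Prop :=
  min (meromorphicOrderAt f z) 0 = ((-(r : ℤ) : ℤ) : WithTop ℤ)

/-- The local factor `∏_j (1 - α_j(p) p^{-s})⁻¹` at `p`. -/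
def eulerFactor {m : ℕ} (α : ℕ → Fin m → ℂ) (p : ℕ) (s : ℂ) : ℂ :=
  ∏ j, (1 - α p j / (p : ℂ) ^ s)⁻¹

/-- The completed function `L(s) N^{s/2} ∏_j Γ_ℝ(s + μ_j)`. At the isolated points where a Gamma
factor has a pole its pointwise value carries no meaning; what is said about it below is said of
the meromorphic function that it represents. -/
def completedL {m : ℕ} (L : ℂ → ℂ) (N : ℕ) (μ : Fin m → ℂ) (s : ℂ) : ℂ :=
  L s * (N : ℂ) ^ (s / 2) * ∏ j, Complex.Gammaℝ (s + μ j)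

/-- The class of `L`-functions: a function `L` with its degree, local parameters, conductor,
spectral parameters, polar order and root number. -/
structure EulerLFunction where
  /-- the degree `m` -/
  degree : ℕ
  degree_pos : 0 < degree
  /-- the local parameters `α_j(p)`; only prime `p` matter -/
  α : ℕ → Fin degree → ℂ
  /-- the exponent `ϑ` in the bound for the local parameters -/
  ϑ : ℝ
  ϑ_nonneg : 0 ≤ ϑ
  ϑ_le_one : ϑ ≤ 1
  norm_α_le : ∀ p : ℕ, p.Prime → ∀ j, ‖α p j‖ ≤ (p : ℝ) ^ ϑ
  /-- the function `L(s)`, continued to `ℂ`; its value at `s = 1` is irrelevant -/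
  L : ℂ → ℂ
  /-- absolute convergence of the Euler product -/
  euler_abs : ∀ s : ℂ, 1 < s.re →
    Summable fun p : Nat.Primes => ‖eulerFactor α p s - 1‖
  /-- the value of the Euler product -/
  euler_hasProd : ∀ s : ℂ, 1 < s.re →
    HasProd (fun p : Nat.Primes => eulerFactor α p s) (L s)
  /-- the conductor `N_L` -/
  conductor : ℕ
  conductor_pos : 0 < conductor
  /-- the parameters `μ_j` of the Gamma factors -/
  μ : Fin degree → ℂ
  neg_one_lt_re_μ : ∀ j, -1 < (μ j).re
  /-- the `μ_j` are closed under complex conjugation, with multiplicity -/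
  μ_conj : ∃ e : Equiv.Perm (Fin degree), ∀ j, μ (e j) = starRingEnd ℂ (μ j)
  /-- `L` is meromorphic on `ℂ`, and holomorphic (in particular at `0`) except perhaps at `1` -/
  meromorphicAt_one : MeromorphicAt L 1
  analyticAt : ∀ s : ℂ, s ≠ 1 → AnalyticAt ℂ L s
  /-- the order `r_L` of the poles of the completed function at `0` and `1` -/
  polarOrder : ℕ
  polarOrder_le : polarOrder ≤ degree
  no_other_pole : ∀ s : ℂ, s ≠ 0 → s ≠ 1 → HasPoleOrder (completedL L conductor μ) s 0
  pole_zero : HasPoleOrder (completedL L conductor μ) 0 polarOrder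
  pole_one : HasPoleOrder (completedL L conductor μ) 1 polarOrder
  /-- the completed function is of order `1` -/
  growth : HasGrowthOrder (completedL L conductor μ) 1
  /-- the root number `κ` -/
  κ : ℂ
  norm_κ : ‖κ‖ = 1
  /-- the functional equation, as an identity of meromorphic functions -/
  functional_equation :
    completedL L conductor μ =ᶠ[codiscrete ℂ]
      fun s => κ * starRingEnd ℂ (completedL L conductor μ (1 - starRingEnd ℂ s))

/-- The completed function `ξ_L`. -/
def EulerLFunction.ξ (F : EulerLFunction) : ℂ → ℂ :=
  completedL F.L F.conductor F.μ

/-- A non-trivial zero: a zero of `L` that does not merely arise from the poles of the Gamma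
factors (counted with multiplicity), that is, one that is still a zero of `ξ_L`. -/
def EulerLFunction.IsNontrivialZero (F : EulerLFunction) (ρ : ℂ) : Prop :=
  0 < meromorphicOrderAt F.L ρ ∧ 0 < meromorphicOrderAt F.ξ ρ

end

/-! Clearing the poles of `ξ` gives an entire function `Ξ` whose zeros are non-trivial zeros of `L`,
and the functional equation makes `‖Ξ‖` symmetric about the line `Re s = 1/2`. Suppose `Ξ` has no
zero with ordinate within `R = 10 ^ 6` of `T`, and let `c = 1/2 + iT`. Then `log ‖Ξ‖` is harmonic on
the disc of radius `R` about `c`, and the symmetry removes its first-order growth to the right of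
`c`. If `log ‖Ξ‖` exceeds its value at `c` by at most `A` on the disc, its increase from `c` to `c +
w` is therefore `O(A (‖w‖ / R) ^ 2)` (`log_norm_sub_log_norm_le_of_symmetric`).

Everything is measured by `K = logSize T`, the logarithm of an analytic conductor, which dominates
the degree. The Gamma factors and the conductor make `log ‖Ξ‖` increase by at least `K` from `20 +
iT` to `30 + iT` (`logSize_le_log_norm_Ξ_sub`). They also bound it far to the right by its value at
`20 + iT` plus `O(K R log R)` (`log_norm_Ξ_le_of_far_right`). That bound is carried back to the
whole disc by the monotonicity lemma `norm_Ξ_sub_le`, a Phragmén–Lindelöf argument for `Ξ(s - h) /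
Ξ(s)`. So `K` would be at most a constant times `K (log R) / R`, which is false for `R = 10 ^ 6`. No
constant depends on `L`, since each estimate is linear in `K`. -/

/-! ### Estimates for the Gamma function, uniform in the imaginary part -/

open Complex in
theorem norm_betaIntegral_le {u v : ℂ} (hu : 0 < u.re) (hv : 1 ≤ v.re) :
    ‖betaIntegral u v‖ ≤ 1 / u.re := by
  have hint : ∫ x : ℝ in (0 : ℝ)..1, x ^ (u.re - 1) = 1 / u.re := by
    rw [integral_rpow (Or.inl (by linarith))]
    simp [hu.ne']
  rw [betaIntegral, ← hint]
  refine intervalIntegral.norm_integral_le_of_norm_le zero_le_one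
    (Eventually.of_forall fun x hx => ?_)
    (intervalIntegral.intervalIntegrable_rpow' (by linarith))
  have hx0 : 0 < x := hx.1
  have hx1 : 0 ≤ 1 - x := by linarith [hx.2]
  rw [norm_mul, norm_cpow_eq_rpow_re_of_pos hx0]
  -- Since `Re v ≥ 1`, this factor can be dropped. Only the integral of `x ^ (Re u - 1)` remains.
  have h2 : ‖(1 - (x : ℂ)) ^ (v - 1)‖ ≤ 1 := by
    rw [show (1 - (x : ℂ)) = ((1 - x : ℝ) : ℂ) by push_cast; ring]
    rcases hx1.eq_or_lt with h | h
    · rw [← h]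
      by_cases hv1 : v - 1 = 0
      · simp [hv1]
      · simp [zero_cpow hv1]
    · rw [norm_cpow_eq_rpow_re_of_pos h]
      exact Real.rpow_le_one h.le (by linarith) (by simpa using hv)
  calc _ ≤ x ^ (u - 1).re * 1 := by gcongr
    _ = x ^ (u.re - 1) := by simp

open Complex in
theorem norm_Gamma_mul_norm_Gamma_le {z w : ℂ} (hz : 0 < z.re) (hw : 1 ≤ w.re) :
    ‖Gamma z‖ * ‖Gamma w‖ ≤ ‖Gamma (z + w)‖ / z.re := by
  rw [← norm_mul, Gamma_mul_Gamma_eq_betaIntegral hz (by linarith), norm_mul, div_eq_mul_one_div]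
  gcongr
  exact norm_betaIntegral_le hz hw

-- The reflection formula gives `|Γ(1 + it)|² = πt / sinh(πt)`, and `sinh y ≤ y e^y` for `y ≥ 0`.
open Complex in
theorem exp_neg_le_norm_Gamma_one_add (t : ℝ) :
    Real.exp (-(Real.pi * |t| / 2)) ≤ ‖Gamma (1 + t * I)‖ := by
  wlog ht : 0 ≤ t generalizing t
  · have h := this (-t) (by linarith)
    rw [abs_neg] at h
    have e : (1 + ((-t : ℝ) : ℂ) * I) = (starRingEnd ℂ) (1 + t * I) := by
      simp
    rwa [e, Gamma_conj, RCLike.norm_conj] at h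
  rcases ht.eq_or_lt with h0 | h0
  · simp [← h0]
  rw [abs_of_nonneg ht]
  have hpt : 0 < Real.pi * t := by positivity
  have hprod : ‖Gamma (1 + t * I)‖ ^ 2 = Real.pi * t / Real.sinh (Real.pi * t) := by
    have hne : (t * I : ℂ) ≠ 0 := by simp [h0.ne']
    have h1 : Gamma (1 + t * I) = (t * I) * Gamma (t * I) := by
      rw [add_comm, Gamma_add_one _ hne]
    have h2 : Gamma (1 - t * I) = (starRingEnd ℂ) (Gamma (1 + t * I)) := by
      rw [← Gamma_conj]; simp [sub_eq_add_neg]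
    have h3 : Gamma (1 + t * I) * Gamma (1 - t * I) = (Real.pi * t) / (Real.sinh (Real.pi * t)) := by
      rw [h1, mul_assoc, Gamma_mul_Gamma_one_sub, ← mul_assoc, sin_mul_I, ofReal_sinh]
      push_cast
      have : sinh (Real.pi * t) ≠ 0 := by
        have := (Real.sinh_pos_iff.2 hpt).ne'
        exact_mod_cast this
      field_simp
    rw [h2, mul_conj, normSq_eq_norm_sq] at h3
    exact_mod_cast h3
  have hs : Real.sinh (Real.pi * t) ≤ Real.pi * t * Real.exp (Real.pi * t) := by
    have h1 := Real.add_one_le_exp (-(2 * (Real.pi * t)))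
    have h2 : Real.exp (-(Real.pi * t)) = Real.exp (Real.pi * t) * Real.exp (-(2 * (Real.pi * t))) := by
      rw [← Real.exp_add]; ring_nf
    rw [Real.sinh_eq, h2]
    nlinarith [Real.exp_pos (Real.pi * t)]
  have hs0 : 0 < Real.sinh (Real.pi * t) := Real.sinh_pos_iff.2 hpt
  refine le_of_sq_le_sq ?_ (norm_nonneg _)
  rw [hprod, ← Real.exp_nat_mul, le_div_iff₀ hs0]
  have : ((2 : ℕ) : ℝ) * -(Real.pi * t / 2) = -(Real.pi * t) := by push_cast; ring
  rw [this, Real.exp_neg, inv_mul_le_iff₀ (Real.exp_pos _)]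
  linarith

open Complex in
theorem norm_Gammaℝ_eq (s : ℂ) :
    ‖Gammaℝ s‖ = Real.pi ^ (-s.re / 2) * ‖Gamma (s / 2)‖ := by
  rw [Gammaℝ_def, norm_mul, norm_cpow_eq_rpow_re_of_pos Real.pi_pos]
  simp

/-- A vertical shift of `Γ_ℝ` is controlled by a horizontal one. -/
theorem norm_Gammaℝ_add_mul_I_le {z : ℂ} (hz : 7 ≤ z.re) (t : ℝ) :
    ‖Complex.Gammaℝ (z + t * Complex.I)‖ ≤ Real.exp |t| * ‖Complex.Gammaℝ (z + 2)‖ := by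
  have hpi := Real.pi_gt_three
  have hpi4 := Real.pi_lt_d2
  set w : ℂ := z / 2 + (t / 2 : ℝ) * Complex.I with hw
  have hwre : w.re = z.re / 2 := by simp [hw]
  -- The second argument cancels the vertical shift and adds 1, which is why `z + 2` appears on the
  -- right.
  have h1 := norm_Gamma_mul_norm_Gamma_le (z := w) (w := 1 + ((-(t / 2) : ℝ) : ℂ) * Complex.I)
    (by rw [hwre]; linarith) (by simp)
  have h2 := exp_neg_le_norm_Gamma_one_add (-(t / 2))
  rw [abs_neg, abs_div, abs_two] at h2
  have e1 : w + (1 + ((-(t / 2) : ℝ) : ℂ) * Complex.I) = (z + 2) / 2 := by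
    rw [hw]; push_cast; ring
  have e2 : (z + t * Complex.I) / 2 = w := by rw [hw]; push_cast; ring
  rw [e1, hwre] at h1
  rw [norm_Gammaℝ_eq, norm_Gammaℝ_eq, e2]
  have e3 : (z + t * Complex.I).re = z.re := by simp
  have e4 : -(z + 2).re / 2 = -z.re / 2 - 1 := by simp; ring
  rw [e3, e4, Real.rpow_sub_one Real.pi_pos.ne']
  have h3 : Real.exp (-|t|) ≤ ‖Complex.Gamma (1 + ((-(t / 2) : ℝ) : ℂ) * Complex.I)‖ := by
    refine le_trans (Real.exp_le_exp.2 ?_) h2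
    nlinarith [abs_nonneg t]
  -- `Re z ≥ 7` gives `Re w ≥ 7/2 > π`. The resulting `1 / π` absorbs the change in the power of
  -- `π`.
  have h4 : ‖Complex.Gamma w‖ * Real.exp (-|t|) ≤ ‖Complex.Gamma ((z + 2) / 2)‖ / Real.pi := by
    refine (mul_le_mul_of_nonneg_left h3 (norm_nonneg _)).trans (h1.trans ?_)
    gcongr
    linarith
  have h5 : ‖Complex.Gamma w‖ ≤ Real.exp |t| * (‖Complex.Gamma ((z + 2) / 2)‖ / Real.pi) := by
    rw [Real.exp_neg, ← div_eq_mul_inv, div_le_iff₀ (Real.exp_pos _)] at h4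
    linarith
  calc _ ≤ Real.pi ^ (-z.re / 2) * (Real.exp |t| * (‖Complex.Gamma ((z + 2) / 2)‖ / Real.pi)) := by
        gcongr
    _ = _ := by ring

theorem norm_Gammaℝ_add_two_mul {z : ℂ} (hz : 0 < z.re) (n : ℕ) :
    ‖Complex.Gammaℝ (z + 2 * n)‖ =
      ‖Complex.Gammaℝ z‖ * ∏ i ∈ Finset.range n, (‖z + 2 * i‖ / (2 * Real.pi)) := by
  induction n with
  | zero => simp
  | succ n ih =>
    have hne : z + 2 * (n : ℂ) ≠ 0 := by
      intro h
      have := congrArg Complex.re h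
      simp at this
      have hn : (0 : ℝ) ≤ n := n.cast_nonneg
      linarith
    rw [Finset.prod_range_succ, ← mul_assoc, ← ih,
      show z + 2 * ((n + 1 : ℕ) : ℂ) = (z + 2 * n) + 2 by push_cast; ring,
      Complex.Gammaℝ_add_two hne]
    simp only [norm_div, norm_mul, Complex.norm_real, Real.norm_eq_abs, abs_of_pos Real.pi_pos,
      Complex.norm_ofNat]
    field_simp

/-- With `x = Re z / 2`, the Beta inequality for `x - 1` and `1 + i Im z / 2` reduces the bound to
`(x - 1) Γ(x - 1) = Γ(x) ≥ 1` and the estimate on the line `Re = 1`. -/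
theorem exp_neg_le_norm_Gammaℝ {z : ℂ} (hz : 4 ≤ z.re) :
    Real.exp (-(2 * ‖z‖)) ≤ ‖Complex.Gammaℝ z‖ := by
  have hpi := Real.pi_gt_three
  have hpi4 := Real.pi_lt_d2
  set x := z.re / 2 with hx
  have hx2 : 2 ≤ x := by rw [hx]; linarith
  have h1 := norm_Gamma_mul_norm_Gamma_le (z := ((x - 1 : ℝ) : ℂ))
    (w := 1 + ((z.im / 2 : ℝ) : ℂ) * Complex.I)
    (by rw [Complex.ofReal_re]; linarith) (by simp)
  have e1 : ((x - 1 : ℝ) : ℂ) + (1 + ((z.im / 2 : ℝ) : ℂ) * Complex.I) = z / 2 := by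
    apply Complex.ext <;> simp [hx]
  rw [e1, Complex.ofReal_re, Complex.Gamma_ofReal, Complex.norm_real, Real.norm_eq_abs,
    abs_of_pos (Real.Gamma_pos_of_pos (by linarith)), le_div_iff₀ (by linarith)] at h1
  have e2 : (x - 1) * Real.Gamma (x - 1) = Real.Gamma x := by
    rw [← Real.Gamma_add_one (by linarith)]; ring_nf
  have h2 := exp_neg_le_norm_Gamma_one_add (z.im / 2)
  have h3 : 1 ≤ Real.Gamma x := by
    have := Real.Gamma_strictMonoOn_Ici.monotoneOn (Set.mem_Ici.2 le_rfl) (Set.mem_Ici.2 hx2) hx2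
    rwa [Real.Gamma_two] at this
  have h4 : Real.exp (-(Real.pi * |z.im / 2| / 2)) ≤ ‖Complex.Gamma (z / 2)‖ := by
    calc _ ≤ 1 * ‖Complex.Gamma (1 + ((z.im / 2 : ℝ) : ℂ) * Complex.I)‖ := by rw [one_mul]; exact h2
      _ ≤ Real.Gamma x * ‖Complex.Gamma (1 + ((z.im / 2 : ℝ) : ℂ) * Complex.I)‖ := by gcongr
      _ ≤ _ := by rw [← e2]; linarith
  rw [norm_Gammaℝ_eq]
  have hlog : Real.log Real.pi ≤ 2 := by
    rw [Real.log_le_iff_le_exp Real.pi_pos]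
    have := Real.quadratic_le_exp_of_nonneg (show (0 : ℝ) ≤ 2 by norm_num)
    linarith
  have h5 : Real.exp (-‖z‖) ≤ Real.pi ^ (-z.re / 2) := by
    rw [Real.rpow_def_of_pos Real.pi_pos]
    refine Real.exp_le_exp.2 ?_
    nlinarith [Complex.re_le_norm z]
  calc Real.exp (-(2 * ‖z‖)) = Real.exp (-‖z‖) * Real.exp (-‖z‖) := by
        rw [← Real.exp_add]; ring_nf
    _ ≤ _ := by
      refine mul_le_mul h5 (le_trans (Real.exp_le_exp.2 ?_) h4) (Real.exp_pos _).le (by positivity)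
      rw [abs_div, abs_two]
      nlinarith [Complex.abs_im_le_norm z, abs_nonneg z.im]

/-- A leftward shift of `Γ_ℝ` by `h ≥ 2` is bounded. -/
theorem norm_Gammaℝ_sub_le {z : ℂ} {h : ℝ} (hh : 2 ≤ h) (hz : 2 ≤ z.re - h) :
    ‖Complex.Gammaℝ (z - h)‖ ≤ Real.pi ^ (h / 2) / Real.Gamma (h / 2) * ‖Complex.Gammaℝ z‖ := by
  have h1 := norm_Gamma_mul_norm_Gamma_le (z := (z - h) / 2) (w := ((h / 2 : ℝ) : ℂ))
    (by simp; linarith) (by rw [Complex.ofReal_re]; linarith)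
  have hG : 0 < Real.Gamma (h / 2) := Real.Gamma_pos_of_pos (by linarith)
  have e1 : (z - h) / 2 + ((h / 2 : ℝ) : ℂ) = z / 2 := by push_cast; ring
  have e2 : ((z - h) / 2 : ℂ).re = (z.re - h) / 2 := by simp
  rw [e1, e2, Complex.Gamma_ofReal, Complex.norm_real, Real.norm_eq_abs, abs_of_pos hG] at h1
  have h2 : ‖Complex.Gamma ((z - h) / 2)‖ ≤ ‖Complex.Gamma (z / 2)‖ / Real.Gamma (h / 2) := by
    rw [le_div_iff₀ hG]
    exact h1.trans (div_le_self (norm_nonneg _) (by linarith))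
  rw [norm_Gammaℝ_eq, norm_Gammaℝ_eq]
  have e3 : -(z - h).re / 2 = h / 2 + -z.re / 2 := by simp; ring
  rw [e3, Real.rpow_add Real.pi_pos]
  calc _ ≤ Real.pi ^ (h / 2) * Real.pi ^ (-z.re / 2) *
      (‖Complex.Gamma (z / 2)‖ / Real.Gamma (h / 2)) := by gcongr
    _ = _ := by ring

/-! ### Growth of zero-free functions with a symmetry -/

open Complex Metric in
/-- A zero-free holomorphic function whose modulus is symmetric about the centre `c` along a line
grows at most quadratically from `c` in that direction. -/
theorem log_norm_sub_log_norm_le_of_symmetric {f : ℂ → ℂ} {c : ℂ} {R A : ℝ} (hR : 0 < R)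
    (hA : 0 < A) (hf : DifferentiableOn ℂ f (ball c R)) (hne : ∀ z ∈ ball c R, f z ≠ 0)
    (hbound : ∀ z ∈ ball c R, Real.log ‖f z‖ ≤ Real.log ‖f c‖ + A) {w : ℂ}
    (hw : ‖w‖ < R / 2) (hsymm : ‖f (c - w)‖ = ‖f (c + w)‖) :
    Real.log ‖f (c + w)‖ - Real.log ‖f c‖ ≤ 8 * A * (‖w‖ / R) ^ 2 := by
  have hopen : IsOpen (ball c R) := isOpen_ball
  have hc : c ∈ ball c R := mem_ball_self hR
  -- `G` is the branch of `log (f / f c)` vanishing at `c`, obtained as a primitive of `f' / f`.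
  obtain ⟨G, hG0, hG⟩ := (((hf.deriv hopen).div hf hne).isExactOn_ball).with_val_at c 0
  have hexp : ∀ z ∈ ball c R, f z = f c * exp (G z) := by
    have hd : ∀ z ∈ ball c R, HasDerivAt (fun z => f z * exp (-G z)) 0 z := by
      intro z hz
      have h1 := (hf.differentiableAt (hopen.mem_nhds hz)).hasDerivAt
      have h2 := (hG z hz).neg.cexp
      refine (h1.mul h2).congr_deriv ?_
      have := hne z hz
      simp only [Pi.div_apply]
      field_simp
      ring
    intro z hz
    have := (convex_ball c R).is_const_of_fderivWithin_eq_zero (𝕜 := ℂ)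
      (f := fun z => f z * exp (-G z))
      (fun x hx => (hd x hx).differentiableAt.differentiableWithinAt)
      (fun x hx => by
        rw [fderivWithin_of_isOpen hopen hx]
        ext
        simp [(hd x hx).deriv]) hz hc
    simp only [hG0, neg_zero, exp_zero, mul_one] at this
    rw [← this, mul_assoc, ← exp_add]
    simp
  have hre : ∀ z ∈ ball c R, (G z).re = Real.log ‖f z‖ - Real.log ‖f c‖ := by
    intro z hz
    rw [hexp z hz, norm_mul, norm_exp, Real.log_mul (norm_ne_zero_iff.2 (hne c hc))
      (Real.exp_pos _).ne', Real.log_exp]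
    ring
  have hadd : ∀ v ∈ ball (0 : ℂ) R, c + v ∈ ball c R := fun v hv => by simpa using hv
  have hsub : ∀ v ∈ ball (0 : ℂ) R, c - v ∈ ball c R := fun v hv => by
    simpa [sub_eq_add_neg] using hv
  -- The even part of `G` vanishes to second order at 0. At `w` the symmetry makes its real part
  -- twice the increment to be bounded.
  set ℓ : ℂ → ℂ := fun v => G (c + v) + G (c - v) with hℓ
  have hℓd : ∀ v ∈ ball (0 : ℂ) R,
      HasDerivAt ℓ ((deriv f / f) (c + v) - (deriv f / f) (c - v)) v := by
    intro v hv
    have h1 := (hG _ (hadd v hv)).comp_const_add c v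
    have h2 := (hG _ (hsub v hv)).comp_const_sub c v
    exact (h1.add h2).congr_deriv (by ring)
  have hℓ0 : ℓ 0 = 0 := by simp [hℓ, hG0]
  have hℓdiff : DifferentiableOn ℂ ℓ (ball 0 R) := fun v hv =>
    (hℓd v hv).differentiableAt.differentiableWithinAt
  have hℓre : Set.MapsTo ℓ (ball 0 R) {z | z.re ≤ 2 * A} := by
    intro v hv
    have h1 := hbound _ (hadd v hv)
    have h2 := hbound _ (hsub v hv)
    simp only [hℓ, Set.mem_ofPred_eq, add_re, hre _ (hadd v hv), hre _ (hsub v hv)]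
    linarith
  -- Borel–Carathéodory turns the one-sided bound `Re ℓ ≤ 2A` into a bound for `‖ℓ‖`. The Schwarz
  -- lemma for a double zero then applies.
  have hℓnorm : Set.MapsTo ℓ (ball 0 (R / 2)) (closedBall (ℓ 0) (4 * A)) := by
    intro v hv
    have hv' : ‖v‖ < R / 2 := by simpa using hv
    have h1 := borelCaratheodory_zero (by positivity) hℓdiff hℓre hR
      (show v ∈ ball 0 R by simp; linarith) hℓ0
    rw [hℓ0, mem_closedBall_zero_iff]
    refine h1.trans ?_
    rw [div_le_iff₀ (by linarith)]
    nlinarith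
  have hℓo : (fun v => ℓ v - ℓ 0) =o[nhds 0] fun v => ‖v - 0‖ ^ 1 := by
    have := (hℓd 0 (mem_ball_self hR)).isLittleO
    simp only [sub_zero, add_zero, sub_self, smul_zero] at this
    simpa using this.norm_right
  have key := dist_le_mul_div_pow_of_mapsTo_ball_of_isLittleO (n := 1)
    (hℓdiff.mono (ball_subset_ball (by linarith))) hℓnorm hℓo (show w ∈ ball 0 (R / 2) by simpa using hw)
  rw [hℓ0, dist_zero_right, dist_zero_right] at key
  have hwR : w ∈ ball (0 : ℂ) R := by simp; linarith
  have h1 : (ℓ w).re = 2 * (Real.log ‖f (c + w)‖ - Real.log ‖f c‖) := by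
    simp only [hℓ, add_re, hre _ (hadd w hwR), hre _ (hsub w hwR), hsymm]
    ring
  have h2 := (re_le_norm (ℓ w)).trans key
  rw [h1] at h2
  have h3 : 4 * A * (‖w‖ / (R / 2)) ^ (1 + 1) = 2 * (8 * A * (‖w‖ / R) ^ 2) := by
    rw [show ‖w‖ / (R / 2) = 2 * (‖w‖ / R) by field_simp]; ring
  linarith

/-! ### The Euler product to the right of the critical strip -/

theorem eulerFactor_ne_zero {m : ℕ} {α : ℕ → Fin m → ℂ} {p : ℕ} {s : ℂ}
    (h : ∀ j, ‖α p j / (p : ℂ) ^ s‖ < 1) : eulerFactor α p s ≠ 0 := by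
  refine Finset.prod_ne_zero_iff.2 fun j _ => inv_ne_zero fun h0 => ?_
  have := h j
  rw [← sub_eq_zero.1 h0] at this
  simp at this

theorem norm_eulerFactor_le {m : ℕ} {α : ℕ → Fin m → ℂ} {p : ℕ} {s : ℂ} {q : ℝ} (hq : q ≤ 1 / 2)
    (h : ∀ j, ‖α p j / (p : ℂ) ^ s‖ ≤ q) : ‖eulerFactor α p s‖ ≤ Real.exp (2 * m * q) := by
  have hq' : 1 - q ≥ Real.exp (-(2 * q)) ∨ q < 0 := by
    by_cases h0 : q < 0
    · exact Or.inr h0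
    left
    rw [Real.exp_neg]
    have := Real.add_one_le_exp (2 * q)
    rw [ge_iff_le, inv_le_iff_one_le_mul₀ (Real.exp_pos _)]
    nlinarith
  rw [eulerFactor, norm_prod]
  calc _ ≤ ∏ _j : Fin m, Real.exp (2 * q) := by
        refine Finset.prod_le_prod (fun _ _ => norm_nonneg _) fun j _ => ?_
        have h0 := (norm_nonneg _).trans (h j)
        have h1 := hq'.resolve_right (not_lt.2 h0)
        have h2 := norm_sub_norm_le (1 : ℂ) (α p j / (p : ℂ) ^ s)
        rw [norm_one] at h2
        rw [norm_inv, inv_le_comm₀ (by linarith [h j]) (Real.exp_pos _), ← Real.exp_neg]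
        linarith [h j]
    _ = _ := by
        rw [Finset.prod_const, ← Real.exp_nat_mul]
        simp; ring

theorem exp_neg_le_norm_eulerFactor {m : ℕ} {α : ℕ → Fin m → ℂ} {p : ℕ} {s : ℂ} {q : ℝ}
    (hq : q < 1) (h : ∀ j, ‖α p j / (p : ℂ) ^ s‖ ≤ q) :
    Real.exp (-(m * q)) ≤ ‖eulerFactor α p s‖ := by
  rw [eulerFactor, norm_prod]
  calc _ = ∏ _j : Fin m, Real.exp (-q) := by
        rw [Finset.prod_const, ← Real.exp_nat_mul]
        simp
    _ ≤ _ := by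
        refine Finset.prod_le_prod (fun _ _ => (Real.exp_pos _).le) fun j _ => ?_
        have h2 := norm_sub_norm_le (1 : ℂ) (α p j / (p : ℂ) ^ s)
        have h3 := norm_sub_le (1 : ℂ) (α p j / (p : ℂ) ^ s)
        rw [norm_one] at h2 h3
        rw [norm_inv, Real.exp_neg]
        refine inv_anti₀ (by linarith [h j]) ?_
        linarith [h j, Real.add_one_le_exp q]

/-- Adding the term `n = 1` leaves a partial sum of `ζ(2) = π² / 6 < 2`. -/
theorem sum_primes_one_div_sq_le (S : Finset Nat.Primes) :
    ∑ p ∈ S, 1 / ((p : ℕ) : ℝ) ^ 2 ≤ 1 := by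
  set e : Nat.Primes ↪ ℕ := ⟨fun p => (p : ℕ), Nat.Primes.coe_nat_injective⟩ with he
  have h1 : (1 : ℝ) + ∑ p ∈ S, 1 / ((p : ℕ) : ℝ) ^ 2 =
      ∑ n ∈ insert 1 (S.map e), 1 / (n : ℝ) ^ 2 := by
    rw [Finset.sum_insert, Finset.sum_map]
    · simp only [Nat.cast_one, one_pow, div_one]
      rfl
    · simp only [Finset.mem_map, not_exists, not_and]
      intro p _ hp
      exact p.2.ne_one hp
  have h2 := sum_le_hasSum (insert 1 (S.map e)) (fun n _ => by positivity) hasSum_zeta_two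
  have h3 := Real.pi_lt_d2
  have h4 := Real.pi_pos
  nlinarith

namespace EulerLFunction

variable (F : EulerLFunction)

theorem norm_localTerm_le (p : Nat.Primes) (j : Fin F.degree) (s : ℂ) :
    ‖F.α p j / ((p : ℕ) : ℂ) ^ s‖ ≤ ((p : ℕ) : ℝ) ^ (1 - s.re) := by
  have hp : (0 : ℝ) < (p : ℕ) := by exact_mod_cast p.2.pos
  have hp1 : (1 : ℝ) ≤ (p : ℕ) := by exact_mod_cast p.2.one_lt.le
  rw [norm_div, Complex.norm_natCast_cpow_of_pos p.2.pos, Real.rpow_sub hp]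
  gcongr
  exact (F.norm_α_le p p.2 j).trans (Real.rpow_le_rpow_of_exponent_le hp1 F.ϑ_le_one)

theorem norm_localTerm_le_one_div_sq (p : Nat.Primes) (j : Fin F.degree) {s : ℂ} (hs : 3 ≤ s.re) :
    ‖F.α p j / ((p : ℕ) : ℂ) ^ s‖ ≤ 1 / ((p : ℕ) : ℝ) ^ 2 := by
  have hp : (0 : ℝ) < (p : ℕ) := by exact_mod_cast p.2.pos
  have hp1 : (1 : ℝ) ≤ (p : ℕ) := by exact_mod_cast p.2.one_lt.le
  refine (F.norm_localTerm_le p j s).trans ?_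
  rw [one_div, ← Real.rpow_natCast, ← Real.rpow_neg hp.le]
  exact Real.rpow_le_rpow_of_exponent_le hp1 (by push_cast; linarith)

theorem L_ne_zero {s : ℂ} (hs : 1 < s.re) : F.L s ≠ 0 := by
  rw [← (F.euler_hasProd s hs).tprod_eq]
  have h := tprod_one_add_ne_zero_of_summable
    (f := fun p : Nat.Primes => eulerFactor F.α p s - 1) (fun p => ?_) (F.euler_abs s hs)
  · simpa using h
  · rw [add_sub_cancel]
    refine eulerFactor_ne_zero fun j => (F.norm_localTerm_le p j s).trans_lt ?_
    exact Real.rpow_lt_one_of_one_lt_of_neg (by exact_mod_cast p.2.one_lt) (by linarith)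

theorem one_div_sq_prime_le (p : Nat.Primes) : 1 / ((p : ℕ) : ℝ) ^ 2 ≤ 1 / 4 := by
  have : (2 : ℝ) ≤ (p : ℕ) := by exact_mod_cast p.2.two_le
  apply one_div_le_one_div_of_le <;> nlinarith

theorem norm_L_le {s : ℂ} (hs : 3 ≤ s.re) : ‖F.L s‖ ≤ Real.exp (2 * F.degree) := by
  have h := (F.euler_hasProd s (by linarith)).norm
  refine le_of_tendsto h (Eventually.of_forall fun S => ?_)
  calc _ ≤ ∏ p ∈ S, Real.exp (2 * F.degree * (1 / ((p : ℕ) : ℝ) ^ 2)) := by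
        refine Finset.prod_le_prod (fun _ _ => norm_nonneg _) fun p _ => ?_
        exact norm_eulerFactor_le (by linarith [one_div_sq_prime_le p])
          fun j => F.norm_localTerm_le_one_div_sq p j hs
    _ = Real.exp (2 * F.degree * ∑ p ∈ S, 1 / ((p : ℕ) : ℝ) ^ 2) := by
        rw [← Real.exp_sum, Finset.mul_sum]
    _ ≤ _ := by
        refine Real.exp_le_exp.2 (mul_le_of_le_one_right (by positivity) (sum_primes_one_div_sq_le S))

theorem exp_neg_le_norm_L {s : ℂ} (hs : 3 ≤ s.re) : Real.exp (-(2 * F.degree)) ≤ ‖F.L s‖ := by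
  have h := (F.euler_hasProd s (by linarith)).norm
  refine ge_of_tendsto h (Eventually.of_forall fun S => ?_)
  calc Real.exp (-(2 * F.degree))
      ≤ Real.exp (-(F.degree * ∑ p ∈ S, 1 / ((p : ℕ) : ℝ) ^ 2)) := by
        refine Real.exp_le_exp.2 ?_
        have h1 := sum_primes_one_div_sq_le S
        have h2 : (0 : ℝ) ≤ F.degree := Nat.cast_nonneg _
        nlinarith
    _ = ∏ p ∈ S, Real.exp (-(F.degree * (1 / ((p : ℕ) : ℝ) ^ 2))) := by
        rw [← Real.exp_sum, Finset.mul_sum, Finset.sum_neg_distrib]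
    _ ≤ _ := by
        refine Finset.prod_le_prod (fun _ _ => (Real.exp_pos _).le) fun p _ => ?_
        exact exp_neg_le_norm_eulerFactor (by linarith [one_div_sq_prime_le p])
          fun j => F.norm_localTerm_le_one_div_sq p j hs

end EulerLFunction

/-! ### The entire function `Ξ`, its zeros and its symmetry -/

open Topology

theorem eventually_nhdsNE_of_mem_codiscrete {X : Type*} [TopologicalSpace X] {S : Set X}
    (hS : S ∈ codiscrete X) (x : X) : S ∈ 𝓝[≠] x := by
  have := mem_codiscrete.1 hS x
  rwa [disjoint_principal_right, compl_compl] at this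

theorem eventually_inv_Gammaℝ_ne_zero (z : ℂ) : ∀ᶠ s in 𝓝[≠] z, (Complex.Gammaℝ s)⁻¹ ≠ 0 := by
  have han : AnalyticOnNhd ℂ (fun s => (Complex.Gammaℝ s)⁻¹) Set.univ := fun s _ =>
    Complex.differentiable_Gammaℝ_inv.analyticAt s
  rcases (han z trivial).eventually_eq_zero_or_eventually_ne_zero with h | h
  · have h1 := han.eqOn_zero_of_preconnected_of_eventuallyEq_zero isPreconnected_univ trivial h
      (Set.mem_univ 1)
    simp [Complex.Gammaℝ_one] at h1
  · exact h

theorem analyticAt_Gammaℝ {z : ℂ} (hz : 0 < z.re) : AnalyticAt ℂ Complex.Gammaℝ z := by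
  have h := (Complex.differentiable_Gammaℝ_inv.analyticAt z).fun_inv
    (inv_ne_zero (Complex.Gammaℝ_ne_zero_of_re_pos hz))
  simpa using h

theorem meromorphicAt_Gammaℝ_add (a z : ℂ) :
    MeromorphicAt (fun s => Complex.Gammaℝ (s + a)) z := by
  have h : Differentiable ℂ fun s => (Complex.Gammaℝ (s + a))⁻¹ :=
    Complex.differentiable_Gammaℝ_inv.comp (differentiable_id.add_const a)
  have := (h.analyticAt z).meromorphicAt.fun_inv
  simpa using this

/-- If `r > 0` then `o = -r` and the sum is 0. If `r = 0` then `o ≥ 0` and nothing is added. So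
clearing a pole of exact order `r` creates no zero. -/
theorem nonneg_and_pos_of_min_eq {o : WithTop ℤ} {r : ℕ}
    (h : min o 0 = ((-(r : ℤ) : ℤ) : WithTop ℤ)) :
    0 ≤ ((r : ℤ) : WithTop ℤ) + o ∧ (0 < ((r : ℤ) : WithTop ℤ) + o → 0 < o) := by
  induction o with
  | top => simp
  | coe o =>
    norm_cast at h ⊢
    omega

namespace EulerLFunction

variable (F : EulerLFunction)

theorem meromorphicAt_L (s : ℂ) : MeromorphicAt F.L s := by
  by_cases h : s = 1
  · exact h ▸ F.meromorphicAt_one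
  · exact (F.analyticAt s h).meromorphicAt

theorem natCast_conductor_ne_zero : (F.conductor : ℂ) ≠ 0 :=
  Nat.cast_ne_zero.2 F.conductor_pos.ne'

theorem differentiable_conductor_cpow (a : ℂ) :
    Differentiable ℂ fun s : ℂ => (F.conductor : ℂ) ^ (s * a) :=
  (differentiable_id.mul_const a).const_cpow (Or.inl F.natCast_conductor_ne_zero)

theorem meromorphicAt_ξ (s : ℂ) : MeromorphicAt F.ξ s := by
  have h1 := ((F.differentiable_conductor_cpow 2⁻¹).analyticAt s).meromorphicAt
  have h2 : MeromorphicAt (fun z => ∏ j, Complex.Gammaℝ (z + F.μ j)) s :=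
    MeromorphicAt.fun_prod fun j _ => meromorphicAt_Gammaℝ_add _ _
  exact ((F.meromorphicAt_L s).mul h1).mul h2

/-- The polynomial factor `(s (s - 1)) ^ r` that clears the poles of `ξ`. -/
noncomputable def polarFactor (s : ℂ) : ℂ := (s * (s - 1)) ^ F.polarOrder

theorem differentiable_polarFactor : Differentiable ℂ F.polarFactor :=
  (differentiable_id.mul (differentiable_id.sub_const 1)).pow _

theorem polarFactor_mul_ξ_meromorphicOn :
    MeromorphicOn (fun s => F.polarFactor s * F.ξ s) Set.univ := fun s _ =>
  (F.differentiable_polarFactor.analyticAt s).meromorphicAt.mul (F.meromorphicAt_ξ s)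

theorem exists_order_polarFactor (z : ℂ) : ∃ k : ℕ,
    meromorphicOrderAt F.polarFactor z = ((k : ℤ) : WithTop ℤ) ∧ HasPoleOrder F.ξ z k := by
  have hpow : ∀ a : ℂ, meromorphicOrderAt (fun s : ℂ => (s - a) ^ F.polarOrder) a =
      ((F.polarOrder : ℤ) : WithTop ℤ) := fun a => meromorphicOrderAt_pow_id_sub_const
  have hne : ∀ g : ℂ → ℂ, Differentiable ℂ g → ∀ a, g a ≠ 0 →
      meromorphicOrderAt (fun s => (s - a) ^ F.polarOrder * g s) a =
        ((F.polarOrder : ℤ) : WithTop ℤ) := fun g hg a ha => by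
    have h := meromorphicOrderAt_mul_of_ne_zero (f := fun s => (s - a) ^ F.polarOrder)
      (hg.analyticAt a) ha
    rw [hpow a] at h
    rw [← h]
    congr 1
    ext s
    simp [mul_comm]
  by_cases h0 : z = 0
  · subst h0
    refine ⟨F.polarOrder, ?_, F.pole_zero⟩
    rw [← hne (fun s => (s - 1) ^ F.polarOrder) ((differentiable_id.sub_const 1).pow _) 0
      (by simp)]
    congr 1
    ext s
    simp [polarFactor, mul_pow]
  by_cases h1 : z = 1
  · subst h1
    refine ⟨F.polarOrder, ?_, F.pole_one⟩
    rw [← hne (fun s => s ^ F.polarOrder) (differentiable_id.pow _) 1 (by simp)]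
    congr 1
    ext s
    simp [polarFactor, mul_pow, mul_comm]
  · refine ⟨0, ?_, F.no_other_pole z h0 h1⟩
    have := (F.differentiable_polarFactor.analyticAt z).meromorphicOrderAt_eq
    rw [this, (F.differentiable_polarFactor.analyticAt z).analyticOrderAt_eq_zero.2]
    · simp
    · exact pow_ne_zero _ (mul_ne_zero h0 (sub_ne_zero.2 h1))

/-- The entire function `Ξ(s) = (s (s - 1)) ^ r ξ(s)`. -/
noncomputable def Ξ : ℂ → ℂ :=
  toMeromorphicNFOn (fun s => F.polarFactor s * F.ξ s) Set.univ

theorem meromorphicOrderAt_Ξ (z : ℂ) : meromorphicOrderAt F.Ξ z =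
    meromorphicOrderAt F.polarFactor z + meromorphicOrderAt F.ξ z := by
  rw [Ξ, meromorphicOrderAt_toMeromorphicNFOn F.polarFactor_mul_ξ_meromorphicOn trivial]
  exact meromorphicOrderAt_mul (F.differentiable_polarFactor.analyticAt z).meromorphicAt
    (F.meromorphicAt_ξ z)

theorem analyticAt_Ξ (z : ℂ) : AnalyticAt ℂ F.Ξ z := by
  have h : MeromorphicNFAt F.Ξ z := meromorphicNFOn_toMeromorphicNFOn _ _ trivial
  rw [← h.meromorphicOrderAt_nonneg_iff_analyticAt, meromorphicOrderAt_Ξ]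
  obtain ⟨k, hk, hp⟩ := F.exists_order_polarFactor z
  rw [hk]
  exact (nonneg_and_pos_of_min_eq hp).1

theorem differentiable_Ξ : Differentiable ℂ F.Ξ := fun z => (F.analyticAt_Ξ z).differentiableAt

theorem Ξ_eventuallyEq (z : ℂ) : F.Ξ =ᶠ[𝓝[≠] z] fun s => F.polarFactor s * F.ξ s :=
  F.polarFactor_mul_ξ_meromorphicOn.toMeromorphicNFOn_eq_self_on_nhdsNE trivial

theorem L_eventuallyEq (z : ℂ) : F.L =ᶠ[𝓝[≠] z] fun s => F.ξ s *
    ((F.conductor : ℂ) ^ (s * (-2⁻¹)) * ∏ j, (Complex.Gammaℝ (s + F.μ j))⁻¹) := by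
  have h : ∀ᶠ s in 𝓝[≠] z, ∀ j, (Complex.Gammaℝ (s + F.μ j))⁻¹ ≠ 0 := by
    refine eventually_all.2 fun j => ?_
    have ht : Tendsto (fun s => s + F.μ j) (𝓝[≠] z) (𝓝[≠] (z + F.μ j)) := by
      refine tendsto_nhdsWithin_iff.2 ⟨?_, ?_⟩
      · exact ((continuous_id.add_const _).tendsto z).mono_left nhdsWithin_le_nhds
      · filter_upwards [self_mem_nhdsWithin] with s hs
        simpa using hs
    exact ht.eventually (eventually_inv_Gammaℝ_ne_zero _)
  filter_upwards [h] with s hs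
  have h1 : (F.conductor : ℂ) ^ (s / 2) * (F.conductor : ℂ) ^ (s * (-2⁻¹)) = 1 := by
    rw [← Complex.cpow_add _ _ F.natCast_conductor_ne_zero]
    ring_nf
    simp
  have h2 : (∏ j, Complex.Gammaℝ (s + F.μ j)) * ∏ j, (Complex.Gammaℝ (s + F.μ j))⁻¹ = 1 := by
    rw [← Finset.prod_mul_distrib]
    exact Finset.prod_eq_one fun j _ => mul_inv_cancel₀ (fun h0 => hs j (by rw [h0, inv_zero]))
  calc F.L s = F.L s * ((F.conductor : ℂ) ^ (s / 2) * (F.conductor : ℂ) ^ (s * (-2⁻¹))) *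
        ((∏ j, Complex.Gammaℝ (s + F.μ j)) * ∏ j, (Complex.Gammaℝ (s + F.μ j))⁻¹) := by
        rw [h1, h2, mul_one, mul_one]
    _ = _ := by rw [ξ, completedL]; ring

/-- `L` is `ξ` times an entire function, because `1 / Γ_ℝ` is entire. -/
theorem order_L_pos {z : ℂ} (h : 0 < meromorphicOrderAt F.ξ z) :
    0 < meromorphicOrderAt F.L z := by
  have hd : Differentiable ℂ fun s : ℂ => (F.conductor : ℂ) ^ (s * (-2⁻¹)) *
      ∏ j, (Complex.Gammaℝ (s + F.μ j))⁻¹ :=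
    (F.differentiable_conductor_cpow _).mul <| Differentiable.fun_finsetProd fun j _ =>
      Complex.differentiable_Gammaℝ_inv.comp (differentiable_id.add_const _)
  rw [(meromorphicOrderAt_congr (F.L_eventuallyEq z)).trans
    (meromorphicOrderAt_mul (F.meromorphicAt_ξ z) (hd.analyticAt z).meromorphicAt)]
  exact add_pos_of_pos_of_nonneg h (hd.analyticAt z).meromorphicOrderAt_nonneg

theorem isNontrivialZero_of_Ξ_eq_zero {z : ℂ} (h : F.Ξ z = 0) : F.IsNontrivialZero z := by
  have h1 : 0 < meromorphicOrderAt F.Ξ z := by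
    refine lt_of_le_of_ne (F.analyticAt_Ξ z).meromorphicOrderAt_nonneg fun h0 => ?_
    rw [(F.analyticAt_Ξ z).meromorphicOrderAt_eq] at h0
    have : analyticOrderAt F.Ξ z = 0 := by
      cases h2 : analyticOrderAt F.Ξ z with
      | top => rw [h2] at h0; simp at h0
      | coe n => rw [h2] at h0; simp at h0; exact_mod_cast h0.symm
    exact (F.analyticAt_Ξ z).analyticOrderAt_eq_zero.1 this h
  obtain ⟨k, hk, hp⟩ := F.exists_order_polarFactor z
  rw [meromorphicOrderAt_Ξ, hk] at h1
  have h2 := (nonneg_and_pos_of_min_eq hp).2 h1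
  exact ⟨F.order_L_pos h2, h2⟩

theorem add_μ_re_pos {s : ℂ} (hs : 1 < s.re) (j : Fin F.degree) : 0 < (s + F.μ j).re := by
  have := F.neg_one_lt_re_μ j
  rw [Complex.add_re]
  linarith

/-- Here `Re (s + μ_j) > 0`, so the product is already analytic and passing to normal form changes
no value. -/
theorem Ξ_eq {s : ℂ} (hs : 1 < s.re) : F.Ξ s = F.polarFactor s * F.ξ s := by
  have hs1 : s ≠ 1 := by rintro rfl; simp at hs
  have h1 := (F.differentiable_conductor_cpow 2⁻¹).analyticAt s
  have h2 : AnalyticAt ℂ (fun z => ∏ j, Complex.Gammaℝ (z + F.μ j)) s :=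
    Finset.analyticAt_fun_prod _ fun j _ =>
      (analyticAt_Gammaℝ (F.add_μ_re_pos hs j)).comp_of_eq (analyticAt_id.add analyticAt_const) rfl
  have h3 : AnalyticAt ℂ F.ξ s := ((F.analyticAt s hs1).mul h1).mul h2
  have h4 : AnalyticAt ℂ (fun s => F.polarFactor s * F.ξ s) s :=
    (F.differentiable_polarFactor.analyticAt s).mul h3
  rw [Ξ, toMeromorphicNFOn_eq_toMeromorphicNFAt F.polarFactor_mul_ξ_meromorphicOn trivial,
    toMeromorphicNFAt_eq_self.2 h4.meromorphicNFAt]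

theorem norm_Ξ_eq {s : ℂ} (hs : 1 < s.re) : ‖F.Ξ s‖ = (‖s‖ * ‖s - 1‖) ^ F.polarOrder *
    (‖F.L s‖ * (F.conductor : ℝ) ^ (s.re / 2) * ∏ j, ‖Complex.Gammaℝ (s + F.μ j)‖) := by
  rw [F.Ξ_eq hs, ξ, completedL, polarFactor]
  simp only [norm_mul, norm_pow, norm_prod, Complex.norm_natCast_cpow_of_pos F.conductor_pos]
  simp

theorem Ξ_ne_zero_of_one_lt_re {s : ℂ} (hs : 1 < s.re) : F.Ξ s ≠ 0 := by
  have hs0 : s ≠ 0 := by rintro rfl; simp at hs; linarith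
  have hs1 : s ≠ 1 := by rintro rfl; simp at hs
  rw [F.Ξ_eq hs, ξ, completedL, polarFactor]
  refine mul_ne_zero (pow_ne_zero _ (mul_ne_zero hs0 (sub_ne_zero.2 hs1)))
    (mul_ne_zero (mul_ne_zero (F.L_ne_zero hs) ?_) (Finset.prod_ne_zero_iff.2 fun j _ =>
      Complex.Gammaℝ_ne_zero_of_re_pos (F.add_μ_re_pos hs j)))
  rw [Complex.cpow_ne_zero_iff]
  exact Or.inl F.natCast_conductor_ne_zero

theorem norm_polarFactor_reflect (s : ℂ) :
    ‖F.polarFactor (1 - starRingEnd ℂ s)‖ = ‖F.polarFactor s‖ := by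
  have h1 : ‖1 - starRingEnd ℂ s‖ = ‖s - 1‖ := by
    rw [norm_sub_rev, ← RCLike.norm_conj (s - 1)]
    simp
  have h2 : ‖1 - starRingEnd ℂ s - 1‖ = ‖s‖ := by
    simp
  simp only [polarFactor, norm_pow, norm_mul, h1, h2, mul_comm]

theorem norm_Ξ_reflect (s : ℂ) : ‖F.Ξ (1 - starRingEnd ℂ s)‖ = ‖F.Ξ s‖ := by
  have hc : Continuous fun z : ℂ => 1 - starRingEnd ℂ z :=
    continuous_const.sub Complex.continuous_conj
  have ht : Tendsto (fun z : ℂ => 1 - starRingEnd ℂ z) (𝓝[≠] s) (𝓝[≠] (1 - starRingEnd ℂ s)) := by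
    refine tendsto_nhdsWithin_iff.2 ⟨(hc.tendsto s).mono_left nhdsWithin_le_nhds, ?_⟩
    filter_upwards [self_mem_nhdsWithin] with z hz h
    exact hz ((starRingEnd ℂ).injective (sub_right_injective h))
  have hfe := eventually_nhdsNE_of_mem_codiscrete F.functional_equation s
  have hX := F.differentiable_Ξ.continuous
  refine tendsto_nhds_unique_of_eventuallyEq (f := fun z => ‖F.Ξ (1 - starRingEnd ℂ z)‖)
    (g := fun z => ‖F.Ξ z‖) (l := 𝓝[≠] s)
    (((hX.comp hc).norm.tendsto s).mono_left nhdsWithin_le_nhds)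
    ((hX.norm.tendsto s).mono_left nhdsWithin_le_nhds) ?_
  filter_upwards [F.Ξ_eventuallyEq s, ht.eventually (F.Ξ_eventuallyEq _), hfe] with z h1 h2 h3
  have h4 : F.ξ z = F.κ * starRingEnd ℂ (F.ξ (1 - starRingEnd ℂ z)) := h3
  rw [h1, h2, norm_mul, norm_mul, F.norm_polarFactor_reflect, h4, norm_mul, F.norm_κ,
    RCLike.norm_conj, one_mul]

theorem re_mem_of_Ξ_eq_zero {z : ℂ} (h : F.Ξ z = 0) : 0 ≤ z.re ∧ z.re ≤ 1 := by
  constructor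
  · by_contra! hz
    have h1 : F.Ξ (1 - starRingEnd ℂ z) ≠ 0 := F.Ξ_ne_zero_of_one_lt_re (by simp; linarith)
    rw [← norm_ne_zero_iff, F.norm_Ξ_reflect, h] at h1
    simp at h1
  · by_contra! hz
    exact F.Ξ_ne_zero_of_one_lt_re hz h

theorem norm_polarFactor_le (s : ℂ) :
    ‖F.polarFactor s‖ ≤ Real.exp (2 * F.polarOrder * ‖s‖) := by
  have h1 : ‖s‖ ≤ Real.exp ‖s‖ := by linarith [Real.add_one_le_exp ‖s‖]
  have h2 : ‖s - 1‖ ≤ Real.exp ‖s‖ := by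
    have := norm_sub_le s 1
    rw [norm_one] at this
    linarith [Real.add_one_le_exp ‖s‖]
  rw [polarFactor, norm_pow, norm_mul]
  calc _ ≤ (Real.exp ‖s‖ * Real.exp ‖s‖) ^ F.polarOrder := by gcongr
    _ = _ := by
      rw [← Real.exp_add, ← Real.exp_nat_mul]
      ring_nf

theorem exists_norm_Ξ_le : ∃ B C ρ : ℝ, 0 ≤ B ∧ ∀ s : ℂ, ρ ≤ ‖s‖ →
    ‖F.Ξ s‖ ≤ C * Real.exp (B * ‖s‖ ^ (3 / 2 : ℝ)) := by
  -- Any exponent strictly between 1 and 2 would do. Phragmén–Lindelöf in a half-plane needs it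
  -- below 2.
  obtain ⟨b, ⟨hb0, hbO⟩, -, hb⟩ := F.growth.exists_between (show (1 : ℝ) < 3 / 2 by norm_num)
  obtain ⟨C, hC0, hC⟩ := hbO.exists_pos
  have h1 := hC.bound
  rw [← Metric.cobounded_eq_cocompact, ← comap_norm_atTop, eventually_comap] at h1
  obtain ⟨ρ, hρ⟩ := eventually_atTop.1 h1
  refine ⟨2 * F.polarOrder + 1, C, max ρ 1 + 1, by positivity, fun s hs => ?_⟩
  have hs' : ‖s‖ ∈ Set.Ioi (max ρ 1) := by
    rw [Set.mem_Ioi]; linarith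
  have hnhds : ∀ᶠ z in 𝓝[≠] s, max ρ 1 < ‖z‖ :=
    (continuous_norm.tendsto s).mono_left nhdsWithin_le_nhds |>.eventually (isOpen_Ioi.mem_nhds hs')
  have hcont : Continuous fun z : ℂ =>
      C * Real.exp ((2 * F.polarOrder + 1) * ‖z‖ ^ (3 / 2 : ℝ)) := by
    have : Continuous fun z : ℂ => ‖z‖ ^ (3 / 2 : ℝ) :=
      continuous_norm.rpow_const fun _ => Or.inr (by norm_num)
    fun_prop
  -- `Ξ` is known to equal the product only on punctured neighbourhoods, so the bound reaches `s` by
  -- continuity.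
  refine le_of_tendsto_of_tendsto (b := 𝓝[≠] s)
    ((F.differentiable_Ξ.continuous.norm.tendsto s).mono_left nhdsWithin_le_nhds)
    ((hcont.tendsto s).mono_left nhdsWithin_le_nhds) ?_
  filter_upwards [hnhds, F.Ξ_eventuallyEq s] with z hz hzΞ
  have hz1 : 1 ≤ ‖z‖ := (le_max_right _ _).trans hz.le
  have h2 := hρ ‖z‖ ((le_max_left _ _).trans hz.le) z rfl
  have h3 : ‖z‖ ≤ ‖z‖ ^ (3 / 2 : ℝ) := Real.self_le_rpow_of_one_le hz1 (by norm_num)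
  have h4 : ‖z‖ ^ b ≤ ‖z‖ ^ (3 / 2 : ℝ) := Real.rpow_le_rpow_of_exponent_le hz1 hb.le
  rw [Real.norm_eq_abs, Real.abs_exp] at h2
  have hr : (0 : ℝ) ≤ F.polarOrder := Nat.cast_nonneg _
  rw [hzΞ, norm_mul]
  calc _ ≤ Real.exp (2 * F.polarOrder * ‖z‖) * (C * Real.exp (‖z‖ ^ b)) := by
        gcongr
        · exact F.norm_polarFactor_le z
        · exact h2
    _ = C * Real.exp (2 * F.polarOrder * ‖z‖ + ‖z‖ ^ b) := by rw [Real.exp_add]; ring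
    _ ≤ _ := by
        gcongr
        nlinarith

end EulerLFunction

/-! ### Monotonicity of `‖Ξ‖` by Phragmén–Lindelöf -/

namespace EulerLFunction

variable (F : EulerLFunction)

theorem one_le_conductor : (1 : ℝ) ≤ F.conductor := by exact_mod_cast F.conductor_pos

theorem exists_exp_neg_le_norm_Ξ : ∃ D : ℝ, 0 ≤ D ∧ ∀ s : ℂ, 5 ≤ s.re →
    Real.exp (-(D + D * ‖s‖)) ≤ ‖F.Ξ s‖ := by
  refine ⟨2 * F.degree + 2 * ∑ j, ‖F.μ j‖, by positivity, fun s hs => ?_⟩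
  rw [F.norm_Ξ_eq (by linarith)]
  have hΓ : Real.exp (-(2 * F.degree * ‖s‖ + 2 * ∑ j, ‖F.μ j‖)) ≤
      ∏ j, ‖Complex.Gammaℝ (s + F.μ j)‖ := by
    calc _ = ∏ j, Real.exp (-(2 * (‖s‖ + ‖F.μ j‖))) := by
          rw [← Real.exp_sum]
          congr 1
          rw [Finset.sum_neg_distrib, ← Finset.mul_sum, Finset.sum_add_distrib]
          simp; ring
      _ ≤ _ := by
          refine Finset.prod_le_prod (fun _ _ => (Real.exp_pos _).le) fun j _ => ?_
          refine le_trans (Real.exp_le_exp.2 ?_) (exp_neg_le_norm_Gammaℝ ?_)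
          · linarith [norm_add_le s (F.μ j)]
          · rw [Complex.add_re]; linarith [F.neg_one_lt_re_μ j]
  have hs5 : 5 ≤ ‖s‖ := hs.trans (Complex.re_le_norm s)
  have hs1 : 4 ≤ ‖s - 1‖ := le_trans (by simp; linarith) (Complex.re_le_norm (s - 1))
  have hP : 1 ≤ (‖s‖ * ‖s - 1‖) ^ F.polarOrder := one_le_pow₀ (by nlinarith)
  have hN : 1 ≤ (F.conductor : ℝ) ^ (s.re / 2) :=
    Real.one_le_rpow F.one_le_conductor (by linarith)
  have hL := F.exp_neg_le_norm_L (s := s) (by linarith)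
  have hμ : 0 ≤ ∑ j, ‖F.μ j‖ := by positivity
  calc _ ≤ 1 * (Real.exp (-(2 * F.degree)) * 1 *
        Real.exp (-(2 * F.degree * ‖s‖ + 2 * ∑ j, ‖F.μ j‖))) := by
        rw [one_mul, mul_one, ← Real.exp_add]
        refine Real.exp_le_exp.2 ?_
        nlinarith
    _ ≤ _ := by gcongr

/-- This supplies boundedness on the real axis for Phragmén–Lindelöf. `K` may depend on `F` and `h`,
since it does not enter the final bound. -/
theorem exists_norm_Ξ_ofReal_sub_le {h : ℝ} (hh : 2 ≤ h) : ∃ K : ℝ, ∀ t : ℝ, 5 ≤ t - h →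
    ‖F.Ξ (t - h)‖ ≤ K * ‖F.Ξ t‖ := by
  set Q := Real.pi ^ (h / 2) / Real.Gamma (h / 2) with hQ
  have hQ0 : 0 < Q := div_pos (Real.rpow_pos_of_pos Real.pi_pos _)
    (Real.Gamma_pos_of_pos (by linarith))
  refine ⟨Real.exp (4 * F.degree) * Q ^ F.degree, fun t ht => ?_⟩
  have hre : ((t : ℂ) - h).re = t - h := by simp
  rw [F.norm_Ξ_eq (by rw [hre]; linarith), F.norm_Ξ_eq (by rw [Complex.ofReal_re]; linarith)]
  have h1 : ‖(t : ℂ) - h‖ ≤ ‖(t : ℂ)‖ := by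
    rw [← Complex.ofReal_sub, Complex.norm_real, Complex.norm_real, Real.norm_eq_abs,
      Real.norm_eq_abs, abs_of_pos (by linarith), abs_of_pos (by linarith)]
    linarith
  have h2 : ‖(t : ℂ) - h - 1‖ ≤ ‖(t : ℂ) - 1‖ := by
    rw [← Complex.ofReal_sub, ← Complex.ofReal_one, ← Complex.ofReal_sub, ← Complex.ofReal_sub,
      Complex.norm_real, Complex.norm_real, Real.norm_eq_abs, Real.norm_eq_abs,
      abs_of_pos (by linarith), abs_of_pos (by linarith)]
    linarith
  have h3 : ‖F.L (t - h)‖ ≤ Real.exp (4 * F.degree) * ‖F.L t‖ := by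
    have ha := F.norm_L_le (s := (t : ℂ) - h) (by rw [hre]; linarith)
    have hb := F.exp_neg_le_norm_L (s := (t : ℂ)) (by rw [Complex.ofReal_re]; linarith)
    calc _ ≤ Real.exp (4 * F.degree) * Real.exp (-(2 * F.degree)) := by
          rw [← Real.exp_add]
          convert ha using 2
          ring
      _ ≤ _ := by gcongr
  have h4 : (F.conductor : ℝ) ^ (((t : ℂ) - h).re / 2) ≤
      (F.conductor : ℝ) ^ ((t : ℂ).re / 2) := by
    refine Real.rpow_le_rpow_of_exponent_le F.one_le_conductor ?_
    rw [hre, Complex.ofReal_re]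
    linarith
  have h5 : ∏ j, ‖Complex.Gammaℝ ((t : ℂ) - h + F.μ j)‖ ≤
      Q ^ F.degree * ∏ j, ‖Complex.Gammaℝ ((t : ℂ) + F.μ j)‖ := by
    calc _ ≤ ∏ j, (Q * ‖Complex.Gammaℝ ((t : ℂ) + F.μ j)‖) := by
          refine Finset.prod_le_prod (fun _ _ => norm_nonneg _) fun j _ => ?_
          rw [sub_add_eq_add_sub]
          refine norm_Gammaℝ_sub_le hh ?_
          rw [Complex.add_re, Complex.ofReal_re]
          linarith [F.neg_one_lt_re_μ j]
      _ = _ := by rw [Finset.prod_mul_distrib]; simp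
  calc _ ≤ (‖(t : ℂ)‖ * ‖(t : ℂ) - 1‖) ^ F.polarOrder *
        (Real.exp (4 * F.degree) * ‖F.L t‖ * (F.conductor : ℝ) ^ ((t : ℂ).re / 2) *
        (Q ^ F.degree * ∏ j, ‖Complex.Gammaℝ ((t : ℂ) + F.μ j)‖)) := by gcongr
    _ = _ := by ring

/-- Moving to the right increases the modulus of `Ξ`, provided that the midpoint of the two
points lies far enough to the right of the critical line. -/
theorem norm_Ξ_sub_le {h : ℝ} (hh : 9 ≤ h) {s : ℂ} (hs : (h + 1) / 2 ≤ s.re) :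
    ‖F.Ξ (s - h)‖ ≤ ‖F.Ξ s‖ := by
  -- On the line `Re s = a` the points `s` and `s - h` are mirror images in the critical line, so
  -- the quotient has modulus 1 there. `h ≥ 9` makes `a ≥ 5`, as the lower bound for `Ξ` requires.
  set a : ℝ := (h + 1) / 2 with ha
  set f : ℂ → ℂ := fun z => F.Ξ (z + a - h) / F.Ξ (z + a) with hf
  have hne : ∀ z : ℂ, 0 ≤ z.re → F.Ξ (z + a) ≠ 0 := fun z hz =>
    F.Ξ_ne_zero_of_one_lt_re (by simp; linarith)
  suffices hmain : ‖f (s - a)‖ ≤ 1 by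
    have h0 : 0 < ‖F.Ξ (s - a + a)‖ := norm_pos_iff.2 (hne _ (by simp; linarith))
    rw [hf] at hmain
    simp only at hmain
    rw [norm_div, div_le_one h0] at hmain
    simpa using hmain
  refine PhragmenLindelof.right_half_plane_of_bounded_on_real (f := f) (C := 1) ?_ ?_ ?_ ?_
    (by simp; linarith)
  · have hcl : closure {z : ℂ | 0 < z.re} ⊆ {z : ℂ | 0 ≤ z.re} :=
      closure_minimal (fun z (hz : 0 < z.re) => hz.le) (isClosed_le continuous_const Complex.continuous_re)
    refine DifferentiableOn.diffContOnCl fun z hz => ?_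
    have hn : DifferentiableAt ℂ (fun z : ℂ => F.Ξ (z + a - h)) z :=
      (F.differentiable_Ξ.comp ((differentiable_id.add_const _).sub_const _)) z
    have hd : DifferentiableAt ℂ (fun z : ℂ => F.Ξ (z + a)) z :=
      (F.differentiable_Ξ.comp (differentiable_id.add_const _)) z
    exact (hn.div hd (hne z (hcl hz))).differentiableWithinAt
  · obtain ⟨B, C, ρ, hB, hC⟩ := F.exists_norm_Ξ_le
    obtain ⟨D, hD, hlow⟩ := F.exists_exp_neg_le_norm_Ξ
    refine ⟨3 / 2, by norm_num, 4 * B + 2 * D, ?_⟩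
    refine Asymptotics.IsBigO.of_bound (C * Real.exp D) (eventually_inf_principal.2 ?_)
    filter_upwards [tendsto_norm_cobounded_atTop.eventually_ge_atTop
      (max (max 1 (ρ + h)) (h + a))] with z hz hzre
    have hz1 : 1 ≤ ‖z‖ := ((le_max_left _ _).trans (le_max_left _ _)).trans hz
    have hz2 : ρ + h ≤ ‖z‖ := ((le_max_right _ _).trans (le_max_left _ _)).trans hz
    have hz3 : h + a ≤ ‖z‖ := (le_max_right _ _).trans hz
    have hzre' : 0 < z.re := hzre
    have hha : ‖(a : ℂ) - h‖ ≤ h := by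
      rw [← Complex.ofReal_sub, Complex.norm_real, Real.norm_eq_abs, abs_le]
      constructor <;> linarith
    have ha' : ‖(a : ℂ)‖ = a := by
      rw [Complex.norm_real, Real.norm_eq_abs, abs_of_pos (by linarith)]
    have e1 : z + a - h = z + (a - h) := by ring
    have n1 : ‖z + a - h‖ ≤ 2 * ‖z‖ := by
      rw [e1]
      linarith [norm_add_le z ((a : ℂ) - h)]
    have n2 : ρ ≤ ‖z + a - h‖ := by
      rw [e1]
      have := norm_sub_le (z + (a - h)) ((a : ℂ) - h)
      rw [add_sub_cancel_right] at this
      linarith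
    have n3 : ‖z + a‖ ≤ 2 * ‖z‖ := by linarith [norm_add_le z (a : ℂ)]
    have hpow : ‖z + a - h‖ ^ (3 / 2 : ℝ) ≤ 4 * ‖z‖ ^ (3 / 2 : ℝ) := by
      calc _ ≤ (2 * ‖z‖) ^ (3 / 2 : ℝ) := by gcongr
        _ = 2 ^ (3 / 2 : ℝ) * ‖z‖ ^ (3 / 2 : ℝ) := Real.mul_rpow (by norm_num) (norm_nonneg _)
        _ ≤ 2 ^ (2 : ℝ) * ‖z‖ ^ (3 / 2 : ℝ) := by
          gcongr
          · norm_num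
          · norm_num
        _ = _ := by norm_num
    have hself : ‖z‖ ≤ ‖z‖ ^ (3 / 2 : ℝ) := Real.self_le_rpow_of_one_le hz1 (by norm_num)
    have hup := hC _ n2
    have hdown := hlow (z + a) (by simp; linarith)
    have hC0 : 0 ≤ C := by
      by_contra! hneg
      have := mul_neg_of_neg_of_pos hneg (Real.exp_pos (B * ‖z + a - h‖ ^ (3 / 2 : ℝ)))
      linarith [norm_nonneg (F.Ξ (z + a - h))]
    rw [hf, Real.norm_eq_abs, Real.abs_exp]
    simp only
    rw [norm_div, div_eq_mul_inv]
    calc _ ≤ C * Real.exp (B * ‖z + a - h‖ ^ (3 / 2 : ℝ)) *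
          (Real.exp (-(D + D * ‖z + a‖)))⁻¹ := by
          gcongr
      _ = C * Real.exp (B * ‖z + a - h‖ ^ (3 / 2 : ℝ) + (D + D * ‖z + a‖)) := by
          rw [← Real.exp_neg, neg_neg, mul_assoc, ← Real.exp_add]
      _ ≤ C * Real.exp (D + (4 * B + 2 * D) * ‖z‖ ^ (3 / 2 : ℝ)) := by
          refine mul_le_mul_of_nonneg_left (Real.exp_le_exp.2 ?_) hC0
          have i1 := mul_le_mul_of_nonneg_left hpow hB
          have i2 := mul_le_mul_of_nonneg_left (n3.trans (mul_le_mul_of_nonneg_left hself zero_le_two)) hD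
          linarith
      _ = _ := by rw [Real.exp_add]; ring
  · obtain ⟨K, hK⟩ := F.exists_norm_Ξ_ofReal_sub_le (h := h) (by linarith)
    refine isBoundedUnder_of_eventually_le (a := K) ?_
    filter_upwards [eventually_ge_atTop h] with x hx
    have h0 : 0 < ‖F.Ξ ((x : ℂ) + a)‖ := norm_pos_iff.2 (hne _ (by simp; linarith))
    rw [hf]
    simp only
    rw [norm_div, div_le_iff₀ h0]
    have := hK (x + a) (by linarith)
    push_cast at this
    exact this
  · intro x
    have e : (x * Complex.I + a - h : ℂ) = 1 - starRingEnd ℂ (x * Complex.I + a) := by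
      rw [ha]
      simp only [map_add, map_mul, Complex.conj_ofReal, Complex.conj_I]
      push_cast
      ring
    rw [hf]
    simp only
    rw [norm_div, e, F.norm_Ξ_reflect, div_self]
    exact norm_ne_zero_iff.2 (hne _ (by simp))

theorem log_norm_Ξ {s : ℂ} (hs : 1 < s.re) : Real.log ‖F.Ξ s‖ =
    F.polarOrder * (Real.log ‖s‖ + Real.log ‖s - 1‖) + (Real.log ‖F.L s‖ +
      s.re / 2 * Real.log F.conductor + ∑ j, Real.log ‖Complex.Gammaℝ (s + F.μ j)‖) := by
  have hs0 : ‖s‖ ≠ 0 := norm_ne_zero_iff.2 (by rintro rfl; simp at hs; linarith)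
  have hs1 : ‖s - 1‖ ≠ 0 := norm_ne_zero_iff.2 (sub_ne_zero.2 (by rintro rfl; simp at hs))
  have hL : ‖F.L s‖ ≠ 0 := norm_ne_zero_iff.2 (F.L_ne_zero hs)
  have hN : 0 < (F.conductor : ℝ) := by linarith [F.one_le_conductor]
  have hN' := (Real.rpow_pos_of_pos hN (s.re / 2)).ne'
  have hΓ : ∀ j, ‖Complex.Gammaℝ (s + F.μ j)‖ ≠ 0 := fun j =>
    norm_ne_zero_iff.2 (Complex.Gammaℝ_ne_zero_of_re_pos (F.add_μ_re_pos hs j))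
  have hprod : ∏ j, ‖Complex.Gammaℝ (s + F.μ j)‖ ≠ 0 := Finset.prod_ne_zero_iff.2 fun j _ => hΓ j
  rw [F.norm_Ξ_eq hs, Real.log_mul (pow_ne_zero _ (mul_ne_zero hs0 hs1))
    (mul_ne_zero (mul_ne_zero hL hN') hprod), Real.log_pow, Real.log_mul hs0 hs1,
    Real.log_mul (mul_ne_zero hL hN') hprod, Real.log_mul hL hN', Real.log_rpow hN,
    Real.log_prod fun j _ => hΓ j]

theorem abs_log_norm_L_le {s : ℂ} (hs : 3 ≤ s.re) : |Real.log ‖F.L s‖| ≤ 2 * F.degree := by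
  have h0 : 0 < ‖F.L s‖ := norm_pos_iff.2 (F.L_ne_zero (by linarith))
  rw [abs_le]
  exact ⟨(Real.le_log_iff_exp_le h0).2 (F.exp_neg_le_norm_L hs),
    (Real.log_le_iff_le_exp h0).2 (F.norm_L_le hs)⟩

end EulerLFunction

/-! ### Growth of `Ξ` measured by `logSize` -/

theorem log_norm_Gammaℝ_add_two_mul {z : ℂ} (hz : 0 < z.re) (n : ℕ) :
    Real.log ‖Complex.Gammaℝ (z + 2 * n)‖ = Real.log ‖Complex.Gammaℝ z‖ +
      ∑ i ∈ Finset.range n, Real.log (‖z + 2 * i‖ / (2 * Real.pi)) := by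
  have hpos : ∀ i : ℕ, 0 < ‖z + 2 * i‖ := fun i => norm_pos_iff.2 fun h => by
    have := congrArg Complex.re h
    simp at this
    have hi : (0 : ℝ) ≤ i := i.cast_nonneg
    linarith
  have hpi := Real.pi_pos
  have hne : ∀ i : ℕ, ‖z + 2 * i‖ / (2 * Real.pi) ≠ 0 := fun i =>
    (div_pos (hpos i) (by positivity)).ne'
  rw [norm_Gammaℝ_add_two_mul hz, Real.log_mul
    (norm_ne_zero_iff.2 (Complex.Gammaℝ_ne_zero_of_re_pos hz))
    (Finset.prod_ne_zero_iff.2 fun i _ => hne i), Real.log_prod fun i _ => hne i]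

/-- `2πe < 19`. This is the reason for the abscissa 20: with `Re μ_j > -1`, every Gamma factor
contributes at least 1 to `logSize`. -/
theorem one_le_log_norm_div_two_pi {z : ℂ} (hz : 19 ≤ z.re) :
    1 ≤ Real.log (‖z‖ / (2 * Real.pi)) := by
  have h1 : 19 ≤ ‖z‖ := hz.trans (Complex.re_le_norm z)
  have hpi := Real.pi_pos
  have hpi2 := Real.pi_lt_d2
  have he := Real.exp_one_lt_d9
  rw [Real.le_log_iff_exp_le (by positivity), le_div_iff₀ (by positivity)]
  nlinarith [Real.exp_pos 1]

theorem log_norm_Gammaℝ_add_two_mul_ge {z : ℂ} (hz : 19 ≤ z.re) (n : ℕ) :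
    Real.log ‖Complex.Gammaℝ z‖ + n * Real.log (‖z‖ / (2 * Real.pi)) ≤
      Real.log ‖Complex.Gammaℝ (z + 2 * n)‖ := by
  have hpi := Real.pi_pos
  have h1 : 19 ≤ ‖z‖ := hz.trans (Complex.re_le_norm z)
  rw [log_norm_Gammaℝ_add_two_mul (by linarith)]
  gcongr
  calc (n : ℝ) * Real.log (‖z‖ / (2 * Real.pi))
      = ∑ _i ∈ Finset.range n, Real.log (‖z‖ / (2 * Real.pi)) := by simp
    _ ≤ _ := by
      refine Finset.sum_le_sum fun i _ => Real.log_le_log (by positivity) ?_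
      gcongr
      rw [← sq_le_sq₀ (norm_nonneg _) (norm_nonneg _), ← Complex.normSq_eq_norm_sq,
        ← Complex.normSq_eq_norm_sq, Complex.normSq_apply, Complex.normSq_apply]
      have hi : (0 : ℝ) ≤ i := i.cast_nonneg
      simp
      nlinarith

/-- The vertical shift costs `|t| ≤ M` and one further step of length 2, hence `M + 1` factors `‖z +
2i‖ / 2π`, each at most `(1 + M) ‖z‖ / 2π`. -/
theorem log_norm_Gammaℝ_add_le {z : ℂ} (hz : 19 ≤ z.re) (M : ℕ) {t : ℝ} (ht : |t| ≤ M) :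
    Real.log ‖Complex.Gammaℝ (z + 2 * M + t * Complex.I)‖ ≤ Real.log ‖Complex.Gammaℝ z‖ + M +
      (M + 1) * (Real.log (‖z‖ / (2 * Real.pi)) + Real.log (1 + M)) := by
  have hpi := Real.pi_pos
  have h1 : 19 ≤ ‖z‖ := hz.trans (Complex.re_le_norm z)
  have hM : (0 : ℝ) ≤ M := M.cast_nonneg
  have hre : 19 ≤ (z + 2 * M).re := by simp; linarith
  have h2 := norm_Gammaℝ_add_mul_I_le (z := z + 2 * M) (by linarith) t
  have e : z + 2 * (M : ℂ) + 2 = z + 2 * ((M + 1 : ℕ) : ℂ) := by push_cast; ring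
  rw [e] at h2
  have hpos : 0 < ‖Complex.Gammaℝ (z + 2 * M + t * Complex.I)‖ :=
    norm_pos_iff.2 (Complex.Gammaℝ_ne_zero_of_re_pos (by simp; linarith))
  have hpos' : ‖Complex.Gammaℝ (z + 2 * ((M + 1 : ℕ) : ℂ))‖ ≠ 0 :=
    norm_ne_zero_iff.2 (Complex.Gammaℝ_ne_zero_of_re_pos (by simp; linarith))
  have h3 := Real.log_le_log hpos h2
  rw [Real.log_mul (Real.exp_pos _).ne' hpos', Real.log_exp,
    log_norm_Gammaℝ_add_two_mul (by linarith)] at h3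
  have h4 : ∑ i ∈ Finset.range (M + 1), Real.log (‖z + 2 * i‖ / (2 * Real.pi)) ≤
      (M + 1) * (Real.log (‖z‖ / (2 * Real.pi)) + Real.log (1 + M)) := by
    calc _ ≤ ∑ _i ∈ Finset.range (M + 1), (Real.log (‖z‖ / (2 * Real.pi)) + Real.log (1 + M)) := by
          refine Finset.sum_le_sum fun i hi => ?_
          have hiM : (i : ℝ) ≤ M := by exact_mod_cast Nat.lt_succ_iff.1 (Finset.mem_range.1 hi)
          have hi0 : (0 : ℝ) ≤ i := i.cast_nonneg
          have hne : 0 < ‖z + 2 * i‖ := lt_of_lt_of_le (by linarith : (0 : ℝ) < 19)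
            (le_trans (by simp; linarith) (Complex.re_le_norm _))
          rw [← Real.log_mul (by positivity) (by positivity)]
          refine Real.log_le_log (by positivity) ?_
          rw [div_mul_eq_mul_div]
          gcongr
          have := norm_add_le z (2 * i)
          simp only [norm_mul, Complex.norm_ofNat, Complex.norm_natCast] at this
          nlinarith
      _ = _ := by simp; ring
  linarith

namespace EulerLFunction

variable (F : EulerLFunction)

/-- A logarithmic size of the functional equation at height `T`. -/
noncomputable def logSize (T : ℝ) : ℝ :=
  Real.log F.conductor + ∑ j, Real.log (‖20 + T * Complex.I + F.μ j‖ / (2 * Real.pi))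

theorem le_re_add_μ (T : ℝ) (j : Fin F.degree) : 19 ≤ (20 + T * Complex.I + F.μ j).re := by
  have := F.neg_one_lt_re_μ j
  simp
  linarith

theorem log_conductor_nonneg : 0 ≤ Real.log F.conductor := Real.log_nonneg F.one_le_conductor

theorem degree_le_logSize (T : ℝ) : (F.degree : ℝ) ≤ F.logSize T := by
  have h : ∑ _j : Fin F.degree, (1 : ℝ) ≤
      ∑ j, Real.log (‖20 + T * Complex.I + F.μ j‖ / (2 * Real.pi)) :=
    Finset.sum_le_sum fun j _ => one_le_log_norm_div_two_pi (F.le_re_add_μ T j)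
  simp only [Finset.sum_const, Finset.card_univ, Fintype.card_fin, nsmul_eq_mul, mul_one] at h
  rw [logSize]
  linarith [F.log_conductor_nonneg]

theorem logSize_pos (T : ℝ) : 0 < F.logSize T := by
  have h : (0 : ℝ) < F.degree := by exact_mod_cast F.degree_pos
  linarith [F.degree_le_logSize T]

/-- Five steps of length 2 gain `5 * logSize T`. The two values of `L` lose at most four times the
degree, hence at most `4 * logSize T`. -/
theorem logSize_le_log_norm_Ξ_sub (T : ℝ) : F.logSize T ≤
    Real.log ‖F.Ξ (30 + T * Complex.I)‖ - Real.log ‖F.Ξ (20 + T * Complex.I)‖ := by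
  set s : ℂ := 20 + T * Complex.I with hs
  have hsre : s.re = 20 := by simp [hs]
  have e : (30 : ℂ) + T * Complex.I = s + 10 := by rw [hs]; ring
  have hsre' : (s + 10).re = 30 := by simp [hsre]; norm_num
  have hΓ : ∑ j, Real.log ‖Complex.Gammaℝ (s + F.μ j)‖ +
      5 * ∑ j, Real.log (‖s + F.μ j‖ / (2 * Real.pi)) ≤
      ∑ j, Real.log ‖Complex.Gammaℝ (s + 10 + F.μ j)‖ := by
    rw [Finset.mul_sum, ← Finset.sum_add_distrib]
    refine Finset.sum_le_sum fun j _ => ?_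
    have h := log_norm_Gammaℝ_add_two_mul_ge (F.le_re_add_μ T j) 5
    rw [show s + 10 + F.μ j = s + F.μ j + 2 * ((5 : ℕ) : ℂ) by push_cast; ring]
    exact_mod_cast h
  have hs20 : 20 ≤ ‖s‖ := hsre ▸ Complex.re_le_norm s
  have hs19 : 19 ≤ ‖s - 1‖ := le_trans (by simp [hsre]; norm_num) (Complex.re_le_norm _)
  have hmono : ∀ w : ℂ, 0 ≤ w.re → ‖w‖ ≤ ‖w + 10‖ := fun w hw => by
    rw [← sq_le_sq₀ (norm_nonneg _) (norm_nonneg _), ← Complex.normSq_eq_norm_sq,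
      ← Complex.normSq_eq_norm_sq, Complex.normSq_apply, Complex.normSq_apply]
    simp
    nlinarith
  have hP1 : Real.log ‖s‖ ≤ Real.log ‖s + 10‖ :=
    Real.log_le_log (by linarith) (hmono s (by linarith))
  have hP2 : Real.log ‖s - 1‖ ≤ Real.log ‖s + 10 - 1‖ := by
    refine Real.log_le_log (by linarith) ?_
    have h := hmono (s - 1) (by simp [hsre])
    rwa [show s - 1 + 10 = s + 10 - 1 by ring] at h
  have hP := mul_le_mul_of_nonneg_left (add_le_add hP1 hP2) (Nat.cast_nonneg (α := ℝ) F.polarOrder)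
  have hL1 := abs_le.1 (F.abs_log_norm_L_le (s := s) (by linarith))
  have hL2 := abs_le.1 (F.abs_log_norm_L_le (s := s + 10) (by linarith))
  have hdeg := F.degree_le_logSize T
  rw [e, F.log_norm_Ξ (by linarith), F.log_norm_Ξ (by linarith), hsre, hsre']
  rw [logSize] at hdeg ⊢
  linarith [hL1.1, hL1.2, hL2.1, hL2.2]

theorem log_norm_Ξ_le_of_far_right (T : ℝ) {M : ℕ} (hM : 1 ≤ M) {t : ℝ} (ht : |t| ≤ M) :
    Real.log ‖F.Ξ (20 + T * Complex.I + 2 * M + t * Complex.I)‖ ≤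
      Real.log ‖F.Ξ (20 + T * Complex.I)‖ + F.logSize T *
        (2 * M + 5 + (M + 1) * Real.log (1 + M) + 2 * Real.log (1 + 3 * M)) := by
  set s : ℂ := 20 + T * Complex.I with hs
  have hM1 : (1 : ℝ) ≤ M := by exact_mod_cast hM
  have hsre : s.re = 20 := by simp [hs]
  set s' : ℂ := s + 2 * M + t * Complex.I with hs'
  have hsre' : s'.re = 20 + 2 * M := by simp [hs', hsre]
  have hΓ : ∑ j, Real.log ‖Complex.Gammaℝ (s' + F.μ j)‖ ≤
      ∑ j, Real.log ‖Complex.Gammaℝ (s + F.μ j)‖ + F.degree * (M + (M + 1) * Real.log (1 + M)) +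
      (M + 1) * ∑ j, Real.log (‖s + F.μ j‖ / (2 * Real.pi)) := by
    calc _ ≤ ∑ j, (Real.log ‖Complex.Gammaℝ (s + F.μ j)‖ + M +
        (M + 1) * (Real.log (‖s + F.μ j‖ / (2 * Real.pi)) + Real.log (1 + M))) := by
          refine Finset.sum_le_sum fun j _ => ?_
          have h := log_norm_Gammaℝ_add_le (F.le_re_add_μ T j) M ht
          rw [← hs] at h
          rwa [show s + F.μ j + 2 * (M : ℂ) + t * Complex.I = s' + F.μ j by rw [hs']; ring] at h
      _ = _ := by
          simp only [mul_add, Finset.sum_add_distrib, Finset.mul_sum]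
          simp
          ring
  have hs20 : 20 ≤ ‖s‖ := hsre ▸ Complex.re_le_norm s
  have hs19 : 19 ≤ ‖s - 1‖ := le_trans (by simp [hsre]; norm_num) (Complex.re_le_norm _)
  have hshift : ∀ w : ℂ, 0 < w.re → 1 ≤ ‖w‖ → Real.log ‖w + (2 * M + t * Complex.I)‖ ≤
      Real.log ‖w‖ + Real.log (1 + 3 * M) := fun w hw0 hw => by
    rw [← Real.log_mul (by positivity) (by positivity)]
    have hpos : 0 < ‖w + (2 * M + t * Complex.I)‖ :=
      lt_of_lt_of_le (by simp; linarith) (Complex.re_le_norm _)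
    refine Real.log_le_log hpos ?_
    have h1 := norm_add_le w (2 * M + t * Complex.I)
    have h2 := norm_add_le (2 * M : ℂ) (t * Complex.I)
    simp at h2
    nlinarith
  have hP1 : Real.log ‖s'‖ ≤ Real.log ‖s‖ + Real.log (1 + 3 * M) := by
    have := hshift s (by linarith) (by linarith)
    rwa [← add_assoc] at this
  have hP2 : Real.log ‖s' - 1‖ ≤ Real.log ‖s - 1‖ + Real.log (1 + 3 * M) := by
    have := hshift (s - 1) (by simp [hsre]) (by linarith)
    convert this using 3
    rw [hs']
    ring
  have hP := mul_le_mul_of_nonneg_left (add_le_add hP1 hP2) (Nat.cast_nonneg (α := ℝ) F.polarOrder)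
  have hl0 : 0 ≤ Real.log (1 + 3 * M) := Real.log_nonneg (by linarith)
  have hl1 : 0 ≤ Real.log (1 + M) := Real.log_nonneg (by linarith)
  have hr : (F.polarOrder : ℝ) ≤ F.degree := by exact_mod_cast F.polarOrder_le
  have hr' := mul_le_mul_of_nonneg_right hr hl0
  have hL1 := abs_le.1 (F.abs_log_norm_L_le (s := s) (by linarith))
  have hL2 := abs_le.1 (F.abs_log_norm_L_le (s := s') (by linarith))
  have hdeg := mul_le_mul_of_nonneg_right (F.degree_le_logSize T)
    (show 0 ≤ M + 4 + (M + 1) * Real.log (1 + M) + 2 * Real.log (1 + 3 * M) by positivity)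
  have hN := F.log_conductor_nonneg
  rw [F.log_norm_Ξ (by linarith), F.log_norm_Ξ (by linarith), hsre, hsre']
  have hK : F.logSize T * (M + 1) = (M + 1) * Real.log F.conductor +
      (M + 1) * ∑ j, Real.log (‖s + F.μ j‖ / (2 * Real.pi)) := by
    rw [logSize]; ring
  linarith [hL1.1, hL1.2, hL2.1, hL2.2]

/-! ### Contradiction from a large zero-free region -/

theorem exists_zero_Ξ_near (T : ℝ) : ∃ z : ℂ, F.Ξ z = 0 ∧ |z.im - T| ≤ 10 ^ 6 := by
  by_contra! hno
  set M : ℕ := 10 ^ 6 with hM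
  have hMR : (M : ℝ) = 10 ^ 6 := by rw [hM]; norm_num
  set c : ℂ := 1 / 2 + T * Complex.I with hc
  have hcre : c.re = 1 / 2 := by simp [hc]
  have hcim : c.im = T := by simp [hc]
  have hball : ∀ z ∈ Metric.ball c (10 ^ 6 : ℝ), |z.re - 1 / 2| < 10 ^ 6 ∧ |z.im - T| < 10 ^ 6 := by
    intro z hz
    rw [Metric.mem_ball, dist_eq_norm] at hz
    constructor
    · have := Complex.abs_re_le_norm (z - c)
      rw [Complex.sub_re, hcre] at this
      linarith
    · have := Complex.abs_im_le_norm (z - c)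
      rw [Complex.sub_im, hcim] at this
      linarith
  have hne : ∀ z ∈ Metric.ball c (10 ^ 6 : ℝ), F.Ξ z ≠ 0 := fun z hz h0 =>
    absurd (hno z h0) (not_lt.2 (hball z hz).2.le)
  have hcmem : c ∈ Metric.ball c (10 ^ 6 : ℝ) := Metric.mem_ball_self (by norm_num)
  set K := F.logSize T with hK
  have hK0 : 0 < K := F.logSize_pos T
  have hstep := F.logSize_le_log_norm_Ξ_sub T
  have hcenter : Real.log ‖F.Ξ c‖ ≤ Real.log ‖F.Ξ (20 + T * Complex.I)‖ := by
    -- The shift `39/2` is the distance from abscissa 20 to `1/2`.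
    refine Real.log_le_log (norm_pos_iff.2 (hne c hcmem)) ?_
    have := F.norm_Ξ_sub_le (h := 39 / 2) (by norm_num) (s := 20 + T * Complex.I)
      (by simp; norm_num)
    convert this using 3
    rw [hc]
    push_cast
    ring
  set B : ℝ := 2 * M + 5 + (M + 1) * Real.log (1 + M) + 2 * Real.log (1 + 3 * M) with hB
  have hlog : Real.log (1 + 3 * M) ≤ 20 := by
    rw [hMR, Real.log_le_iff_le_exp (by norm_num)]
    have he := Real.exp_one_gt_d9
    calc (1 + 3 * 10 ^ 6 : ℝ) ≤ (2.7 : ℝ) ^ 20 := by norm_num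
      _ ≤ Real.exp 1 ^ 20 := by gcongr; linarith
      _ = Real.exp 20 := by rw [← Real.exp_nat_mul]; norm_num
  have hlog' : Real.log (1 + M) ≤ 20 := by
    refine le_trans (Real.log_le_log (by positivity) ?_) hlog
    linarith [M.cast_nonneg (α := ℝ)]
  have hB1 : B ≤ 23 * 10 ^ 6 := by
    rw [hB, hMR] at *
    linarith
  have hB0 : 0 < B := by
    have h1 : 0 ≤ Real.log (1 + (M : ℝ)) := Real.log_nonneg (by linarith [M.cast_nonneg (α := ℝ)])
    have h2 : 0 ≤ Real.log (1 + 3 * (M : ℝ)) :=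
      Real.log_nonneg (by linarith [M.cast_nonneg (α := ℝ)])
    positivity
  set A : ℝ := K * B + (Real.log ‖F.Ξ (20 + T * Complex.I)‖ - Real.log ‖F.Ξ c‖) with hA
  have hA0 : 0 < A := by
    have := mul_pos hK0 hB0
    linarith
  have hbound : ∀ z ∈ Metric.ball c (10 ^ 6 : ℝ),
      Real.log ‖F.Ξ z‖ ≤ Real.log ‖F.Ξ c‖ + A := by
    intro z hz
    obtain ⟨hz1, hz2⟩ := hball z hz
    rw [abs_lt] at hz1
    -- Each point of the disc is compared with the point at the same height on `Re s = 20 + 2M`,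
    -- where the Euler product controls `Ξ`.
    have h1 := F.norm_Ξ_sub_le (h := 20 + 2 * M - z.re) (by linarith)
      (s := 20 + T * Complex.I + 2 * M + ((z.im - T : ℝ) : ℂ) * Complex.I)
      (by simp; linarith)
    have e : 20 + T * Complex.I + 2 * M + ((z.im - T : ℝ) : ℂ) * Complex.I -
        ((20 + 2 * M - z.re : ℝ) : ℂ) = z := by
      apply Complex.ext <;> simp
    rw [e] at h1
    have h2 := F.log_norm_Ξ_le_of_far_right T (M := M) (by norm_num [hM]) (t := z.im - T)
      (by rw [hMR]; exact hz2.le)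
    have h3 := Real.log_le_log (norm_pos_iff.2 (hne z hz)) h1
    linarith
  have hw : ‖((59 / 2 : ℝ) : ℂ)‖ = 59 / 2 := by
    rw [Complex.norm_real, Real.norm_eq_abs, abs_of_pos (by norm_num)]
  have hsymm : ‖F.Ξ (c - ((59 / 2 : ℝ) : ℂ))‖ = ‖F.Ξ (c + ((59 / 2 : ℝ) : ℂ))‖ := by
    rw [← F.norm_Ξ_reflect (c + _)]
    congr 2
    rw [hc]
    simp only [map_add, map_mul, map_div₀, map_one, map_ofNat, Complex.conj_ofReal, Complex.conj_I]
    push_cast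
    ring
  have key := log_norm_sub_log_norm_le_of_symmetric (by norm_num : (0 : ℝ) < 10 ^ 6) hA0
    F.differentiable_Ξ.differentiableOn hne hbound (w := ((59 / 2 : ℝ) : ℂ))
    (by rw [hw]; norm_num) hsymm
  have e30 : c + ((59 / 2 : ℝ) : ℂ) = 30 + T * Complex.I := by
    rw [hc]; push_cast; ring
  rw [e30, hw] at key
  -- Let `δ ≥ 0` be the increase of `log ‖Ξ‖` from `c` to `20 + iT`. Then `K + δ ≤ 8 (K B + δ) (29.5
  -- / 10 ^ 6) ^ 2`, and `B ≤ 23 * 10 ^ 6` makes the coefficient of `K` on the right about `0.16`.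
  have hKB := mul_le_mul_of_nonneg_left hB1 hK0.le
  linarith

theorem exists_isNontrivialZero_near (T : ℝ) : ∃ ρ : ℂ, F.IsNontrivialZero ρ ∧
    0 ≤ ρ.re ∧ ρ.re ≤ 1 ∧ T - 10 ^ 6 ≤ ρ.im ∧ ρ.im ≤ T + 10 ^ 6 := by
  obtain ⟨z, hz, hT⟩ := F.exists_zero_Ξ_near T
  rw [abs_le] at hT
  exact ⟨z, F.isNontrivialZero_of_Ξ_eq_zero hz, (F.re_mem_of_Ξ_eq_zero hz).1,
    (F.re_mem_of_Ξ_eq_zero hz).2, by linarith, by linarith⟩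

end EulerLFunction

theorem corollary1 :
    ∃ N₀ : ℝ, 0 < N₀ ∧ ∀ F : EulerLFunction,
      (∀ T : ℝ, ∃ ρ : ℂ, F.IsNontrivialZero ρ ∧
        0 ≤ ρ.re ∧ ρ.re ≤ 1 ∧ T - N₀ ≤ ρ.im ∧ ρ.im ≤ T + N₀) ∧
      (∀ ρ₁ ρ₂ : ℂ, F.IsNontrivialZero ρ₁ → F.IsNontrivialZero ρ₂ → ρ₁.im < ρ₂.im →
        (∀ ρ : ℂ, F.IsNontrivialZero ρ → ¬ (ρ₁.im < ρ.im ∧ ρ.im < ρ₂.im)) →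
        ρ₂.im - ρ₁.im ≤ 2 * N₀) := by
  refine ⟨10 ^ 6, by norm_num, fun F => ⟨F.exists_isNontrivialZero_near, ?_⟩⟩
  intro ρ₁ ρ₂ _ _ _ hgap
  by_contra! hlt
  -- A gap longer than `2 * N₀` strictly contains the window centred at its midpoint.
  obtain ⟨ρ, hρ, -, -, h1, h2⟩ := F.exists_isNontrivialZero_near ((ρ₁.im + ρ₂.im) / 2)
  exact hgap ρ hρ ⟨by linarith, by linarith⟩
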